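/- Let $$A=\begin{pmatrix}2&1&1&0&0&0\\0&1&0&2&1&0\\0&0&1&0&1&2\end{pmatrix},$$ the incidence matrix of the complete graph on three vertices $a,b,c$ with self-loops (columns: the edges $aa,ab,ac,bb,bc,cc$). Definitions. For an integer matrix $B$ with $n$ columns, let $\mathbb{N}B=\{Bx : x\in\mathbb{N}^n\}$; the $b$-fiber of $B$ is $\mathcal F_{B,b}=\{x\in\mathbb{N}^n : Bx=b\}$; a move for $B$ is an element $z$ of $\ker_{\mathbb Z}B$, written $z=z^+-z^-$ with positive part $z^+$ and negative part $z^-$; its degree is $\max(|z^+|,|z^-|)$, where $|\cdot|$ is the 1-norm (so $|z^+|=|z^-|=|z|/2$ if $B$ is a configuration). A set $M$ of moves is a Markov basis for $B$ if any two elements of any fiber are joined by a path inside this fiber whose steps add or subtract elements of $M$. The Markov degree $\mathrm{MD}(B)$ is the least $m$ such that the moves of degree at most $m$ form a Markov basis for $B$. A non-zero move $z$ is indispensable if the fiber containing $z^+$ and $z^-$ is $\{z^+,z^-\}$. For $b\in\mathbb{N}A$, $A_b$ is the matrix whose columns are the elements of $\mathcal F_{A,b}$. The $N$-th Lawrence lifting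 $A^{(N)}$ of $A$ is the matrix that sends $(z_1,\dots,z_N)$ to $(Az_1,\dots,Az_N,\,z_1+\dots+z_N)$; the type of $(z_1,\dots,z_N)$ is the number of its non-zero layers $z_k$. The Markov complexity $\mathrm{MC}(A)$ is the least $m$ such that for every $N\ge 1$ the moves of type at most $m$ form a Markov basis for $A^{(N)}$. The toric ideal of an integer matrix over a field $K$ is the kernel of the $K$-algebra homomorphism from a polynomial ring to a Laurent polynomial ring that sends the $j$-th variable to the monomial whose exponent is the $j$-th column. Theorem. The following hold. 1. $\max_{b\in\mathbb{N}A}\mathrm{MD}(A_b)=3$. 2. $\mathrm{MC}(A)=5$. Moreover $z=(z_1,\dots,z_5)$ with $z_1=z_2=(1,-1,-1,0,1,0)$, $z_3=(-1,2,0,-1,0,0)$, $z_4=(0,0,0,1,-2,1)$, $z_5=(-1,0,2,0,0,-1)$ is an indispensable move of type $5$ for $A^{(5)}$. 3. $\max_{b\in\mathbb{N}A\setminus\{(2,2,2)\}}\mathrm{MD}(A_b)=2$. 4. $\mathrm{MD}(A_{(2,2,2)})=3$. Moreover, with the columns $\mathbf a_1=(1,0,0,1,0,1)$, $\mathbf a_2=(1,0,0,0,2,0)$,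 $\mathbf a_3=(0,2,0,0,0,1)$, $\mathbf a_4=(0,1,1,0,1,0)$, $\mathbf a_5=(0,0,2,1,0,0)$ of $A_{(2,2,2)}$ and corresponding variables $X_1,\dots,X_5$, the toric ideal of $A_{(2,2,2)}$ over any field is the principal ideal generated by $X_1X_4^2-X_2X_3X_5$, of degree $3$. -/

import Mathlib

namespace MarkovConfig

open scoped Matrix

section General

variable {d n : Type*} [Fintype n]

/-- Moves for `A`: the integer kernel of `A`. -/
def moves (A : Matrix d n ℤ) : Set (n → ℤ) :=
  {z | A *ᵥ z = 0}

/-- The `b`-fiber of `A`: the non-negative integer vectors `x` with `A x = b`. -/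
def fiber (A : Matrix d n ℤ) (b : d → ℤ) : Set (n → ℕ) :=
  {x | A *ᵥ (fun j => (x j : ℤ)) = b}

/-- `ℕA`, the set of all `A x` with `x` a non-negative integer vector. -/
def natSpan (A : Matrix d n ℤ) : Set (d → ℤ) :=
  {b | ∃ x : n → ℕ, A *ᵥ (fun j => (x j : ℤ)) = b}

/-- One step inside the `b`-fiber of `A`, adding or subtracting an element of `M`. -/
def Step (A : Matrix d n ℤ) (M : Set (n → ℤ)) (b : d → ℤ) (x y : n → ℕ) : Prop :=
  x ∈ fiber A b ∧ y ∈ fiber A b ∧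
    ((fun j => (y j : ℤ) - (x j : ℤ)) ∈ M ∨ (fun j => (x j : ℤ) - (y j : ℤ)) ∈ M)

/-- `M` is a Markov basis for `A`: a set of moves by which every fiber of `A` is connected.
(The set is not required to be finite.) -/
def IsMarkovBasis (A : Matrix d n ℤ) (M : Set (n → ℤ)) : Prop :=
  M ⊆ moves A ∧ ∀ b : d → ℤ, ∀ x ∈ fiber A b, ∀ y ∈ fiber A b,
    Relation.ReflTransGen (Step A M b) x y

/-- The degree of an integer vector `z = z⁺ - z⁻`, i.e. the larger one of the 1-norms of `z⁺`
and `z⁻` (these are equal, to half of the 1-norm of `z`, if `z` is a move for a configuration). -/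
def degree (z : n → ℤ) : ℕ :=
  max (∑ j, (z j).toNat) (∑ j, (-z j).toNat)

/-- The Markov degree of `A`: the least `m` such that the moves of degree at most `m` form a
Markov basis for `A` (`⊤` if there were no such `m`). -/
noncomputable def markovDegree (A : Matrix d n ℤ) : ℕ∞ :=
  ⨅ m ∈ {m : ℕ | IsMarkovBasis A {z | z ∈ moves A ∧ degree z ≤ m}}, (m : ℕ∞)

/-- A move `z = z⁺ - z⁻` is indispensable if it is non-zero and the fiber that contains `z⁺` and
`z⁻` is `{z⁺, z⁻}`. -/
def IsIndispensable (A : Matrix d n ℤ) (z : n → ℤ) : Prop :=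
  z ∈ moves A ∧ z ≠ 0 ∧
    fiber A (A *ᵥ fun j => ((z j).toNat : ℤ)) =
      {(fun j => (z j).toNat), (fun j => (-z j).toNat)}

/-- The matrix `A_b` whose columns are the elements of the `b`-fiber of `A`. -/
def fiberMatrix (A : Matrix d n ℤ) (b : d → ℤ) : Matrix n (fiber A b) ℤ :=
  Matrix.of fun j x => (x.1 j : ℤ)

/-- The `N`-th Lawrence lifting of `A`. An integer vector `z` on its columns consists of the
`N` layers `z (·, k)`; the matrix sends it to the `A z (·, k)` and the sum of the layers. -/
def lawrence [DecidableEq n] (A : Matrix d n ℤ) (N : ℕ) :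
    Matrix ((d × Fin N) ⊕ n) (n × Fin N) ℤ :=
  Matrix.fromRows (Matrix.blockDiagonal fun _ : Fin N => A)
    (Matrix.of fun i p => if i = p.1 then 1 else 0)

/-- The `k`-th layer (slice) of `z`. -/
def layer {N : ℕ} (z : n × Fin N → ℤ) (k : Fin N) : n → ℤ :=
  fun j => z (j, k)

/-- The type of `z`: the number of its non-zero layers. -/
def moveType [DecidableEq n] {N : ℕ} (z : n × Fin N → ℤ) : ℕ :=
  (Finset.univ.filter fun k => layer z k ≠ 0).card

/-- The Markov complexity of `A`: the least `m` such that for every `N ≥ 1` the moves of type at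
most `m` form a Markov basis for the `N`-th Lawrence lifting (`⊤` if there were no such `m`). -/
noncomputable def markovComplexity [DecidableEq n] (A : Matrix d n ℤ) : ℕ∞ :=
  ⨅ m ∈ {m : ℕ | ∀ N : ℕ, 1 ≤ N →
    IsMarkovBasis (lawrence A N) {z | z ∈ moves (lawrence A N) ∧ moveType z ≤ m}}, (m : ℕ∞)

end General

/-- The toric ideal of `A` over `K`: the kernel of the `K`-algebra homomorphism from the polynomial
ring to the ring of Laurent polynomials that sends the variable `X j` to the monomial whose
exponent is the `j`-th column of `A`. -/
noncomputable def toricIdeal (K : Type*) [Field K] {d n : Type*} (A : Matrix d n ℤ) :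
    Ideal (MvPolynomial n K) :=
  RingHom.ker (MvPolynomial.aeval (R := K)
    (fun j => (AddMonoidAlgebra.single (fun i => A i j) 1 : AddMonoidAlgebra K (d → ℤ))))

/-- The incidence matrix of the complete graph on the vertices `a, b, c` with self-loops; the
columns are the edges `aa, ab, ac, bb, bc, cc`. -/
def triangle : Matrix (Fin 3) (Fin 6) ℤ :=
  !![2, 1, 1, 0, 0, 0;
     0, 1, 0, 2, 1, 0;
     0, 0, 1, 0, 1, 2]

theorem finite_fiber_triangle (b : Fin 3 → ℤ) : (fiber triangle b).Finite := by
  refine (Set.finite_Iic (fun _ : Fin 6 => (b 0 + b 1 + b 2).toNat)).subset ?_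
  intro x hx
  have h0 := congrFun hx 0
  have h1 := congrFun hx 1
  have h2 := congrFun hx 2
  simp [triangle, Matrix.mulVec, dotProduct, Fin.sum_univ_succ] at h0 h1 h2
  intro j
  fin_cases j <;> simp <;> omega

noncomputable instance (b : Fin 3 → ℤ) : Fintype (fiber triangle b) :=
  (finite_fiber_triangle b).fintype

/-- The first column of the matrix of the fiber of `(2,2,2)`. -/
def col1 : fiber triangle ![2, 2, 2] := ⟨![1, 0, 0, 1, 0, 1], by unfold fiber triangle; decide⟩
/-- The second column. -/
def col2 : fiber triangle ![2, 2, 2] := ⟨![1, 0, 0, 0, 2, 0], by unfold fiber triangle; decide⟩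
/-- The third column. -/
def col3 : fiber triangle ![2, 2, 2] := ⟨![0, 2, 0, 0, 0, 1], by unfold fiber triangle; decide⟩
/-- The fourth column. -/
def col4 : fiber triangle ![2, 2, 2] := ⟨![0, 1, 1, 0, 1, 0], by unfold fiber triangle; decide⟩
/-- The fifth column. -/
def col5 : fiber triangle ![2, 2, 2] := ⟨![0, 0, 2, 1, 0, 0], by unfold fiber triangle; decide⟩

/-- An integer vector with five layers on the edges `aa, ab, ac, bb, bc, cc`. -/
def fiveLayers : Fin 6 × Fin 5 → ℤ := fun p =>
  (![![1, -1, -1, 0, 1, 0],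
     ![1, -1, -1, 0, 1, 0],
     ![-1, 2, 0, -1, 0, 0],
     ![0, 0, 0, 1, -2, 1],
     ![-1, 0, 2, 0, 0, -1]] : Fin 5 → Fin 6 → ℤ) p.2 p.1

end MarkovConfig

open MarkovConfig

/-!
The kernel of `triangle` is `ℤ³`, coordinatized by the three loops (`kerVec`), and every kernel vector
is a sign-compatible sum of the twenty vectors `±e_i`, `±(e_i + e_j)`, `±(e_i - e_j)`, `±(1, 1, 1)`
(`exists_graver_decomposition`). Both halves of the theorem rest on this.

**Markov complexity.** Given two points `x ≠ y` of a fiber of a Lawrence lifting, decompose the layers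
of `y - x` into such pieces, whose total sum is zero. If two pieces clash, that is, if they can be
shortened by shifting a kernel vector between their layers, a move of type two brings the points
closer to each other. The pieces that do not clash with `±(1, 1, 1)` lie on one side of a plane, and
the same holds for `±(e_i - e_j)`; so without a clash there are only pieces `±e_i` and `±(e_i + e_j)`,
and these contain a zero-sum subset of at most five pieces (`counts_eq_zero`), which is a move of type
at most five. Hence `MC ≤ 5`. The five-element zero-sum subsets have the shape of `fiveLayers`, whose
layers have two-element fibers without proper zero-sum subset; this makes it indispensable, so
`MC ≥ 5`.

**Markov degrees.** A point of a fiber of `A_b` is a multiset of elements of the `b`-fiber of `A`, and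
a move of degree two exchanges two elements for two others with the same sum. Minimize the sum of the
squared norms of the elements under such exchanges. In a minimal multiset the numbers of loops of
two elements differ by at most one at each vertex (`EnergyMinimal.loop_le_add_one`), so that its
elements are vertices of a unit cube in `ℤ³`, cut by the three inequalities for the edges `ab, ac, bc`;
moreover two elements are comparable in the cube unless their join is missing in the fiber
(`EnergyMinimal.comparable`). Such a multiset is determined by its cardinality and its sum
(`cube_counts_unique`), unless it contains the three atoms of the cube while no join of two atoms is
in the fiber. Then `100 + 010 + 001 = 2 · 000 + 111` is a cubic relation; it is a consequence of
quadratic ones as soon as there is an element with fewer loops than the cube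
(`EnergyMinimal.not_three_atoms`), and the only fiber without such an element is that of `(2, 2, 2)`.

**The fiber of `(2, 2, 2)`.** Its matrix has a kernel of rank one, generated by the cubic relation
(`exists_nsmul_cubic`), from which the Markov degree and the toric ideal can be read off.
-/

namespace MarkovConfig

open scoped Matrix

/-! ### The kernel of the triangle matrix and its primitive vectors -/

/-- The kernel vector of `triangle` whose entries at the loops `aa, bb, cc` are `α, β, γ`. The loops
determine a kernel vector, so this is a coordinate system `ℤ³ ≃ ker triangle`. -/
def kerVec (α β γ : ℤ) : Fin 6 → ℤ :=
  ![α, γ - α - β, β - α - γ, β, α - β - γ, γ]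

/-- The Graver basis of `triangle`: the kernel vectors that are no sign-compatible sum of two
non-zero kernel vectors. Entry `a + 10` is the negative of entry `a`. -/
def graver : Fin 20 → Fin 6 → ℤ :=
  ![kerVec 1 0 0, kerVec 0 1 0, kerVec 0 0 1, kerVec 1 1 0, kerVec 1 0 1, kerVec 0 1 1,
    kerVec 1 (-1) 0, kerVec 1 0 (-1), kerVec 0 1 (-1), kerVec 1 1 1,
    kerVec (-1) 0 0, kerVec 0 (-1) 0, kerVec 0 0 (-1), kerVec (-1) (-1) 0, kerVec (-1) 0 (-1),
    kerVec 0 (-1) (-1), kerVec (-1) 1 0, kerVec (-1) 0 1, kerVec 0 (-1) 1, kerVec (-1) (-1) (-1)]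

/-- `g` is a conformal part of `d`: entrywise, `g` lies between `0` and `d`. -/
def Conformal (g d : Fin 6 → ℤ) : Prop :=
  ∀ j, (0 ≤ g j ∧ g j ≤ d j) ∨ (d j ≤ g j ∧ g j ≤ 0)

theorem triangle_mulVec (z : Fin 6 → ℤ) : triangle *ᵥ z =
    ![2 * z 0 + z 1 + z 2, z 1 + 2 * z 3 + z 4, z 2 + z 4 + 2 * z 5] := by
  ext i
  fin_cases i <;> simp [triangle, Matrix.mulVec, dotProduct, Fin.sum_univ_succ] <;> ring

theorem triangle_mulVec_eq_iff (z : Fin 6 → ℤ) (b : Fin 3 → ℤ) : triangle *ᵥ z = b ↔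
    2 * z 0 + z 1 + z 2 = b 0 ∧ z 1 + 2 * z 3 + z 4 = b 1 ∧ z 2 + z 4 + 2 * z 5 = b 2 := by
  rw [triangle_mulVec, funext_iff]
  simp [Fin.forall_fin_succ]

theorem mem_moves_triangle_iff (z : Fin 6 → ℤ) : z ∈ moves triangle ↔
    2 * z 0 + z 1 + z 2 = 0 ∧ z 1 + 2 * z 3 + z 4 = 0 ∧ z 2 + z 4 + 2 * z 5 = 0 :=
  triangle_mulVec_eq_iff z 0

theorem kerVec_mem_moves (α β γ : ℤ) : kerVec α β γ ∈ moves triangle := by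
  rw [mem_moves_triangle_iff]
  simp [kerVec]
  refine ⟨?_, ?_, ?_⟩ <;> ring

theorem graver_mem_moves (a : Fin 20) : graver a ∈ moves triangle := by
  fin_cases a <;> exact kerVec_mem_moves _ _ _

theorem sub_mem_moves_triangle {x y : Fin 6 → ℤ} (hx : x ∈ moves triangle)
    (hy : y ∈ moves triangle) : x - y ∈ moves triangle := by
  simp only [moves, Set.mem_ofPred_eq, Matrix.mulVec_sub] at *
  rw [hx, hy, sub_zero]

theorem conformal_iff (g d : Fin 6 → ℤ) : Conformal g d ↔
    ((0 ≤ g 0 ∧ g 0 ≤ d 0) ∨ (d 0 ≤ g 0 ∧ g 0 ≤ 0)) ∧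
    ((0 ≤ g 1 ∧ g 1 ≤ d 1) ∨ (d 1 ≤ g 1 ∧ g 1 ≤ 0)) ∧
    ((0 ≤ g 2 ∧ g 2 ≤ d 2) ∨ (d 2 ≤ g 2 ∧ g 2 ≤ 0)) ∧
    ((0 ≤ g 3 ∧ g 3 ≤ d 3) ∨ (d 3 ≤ g 3 ∧ g 3 ≤ 0)) ∧
    ((0 ≤ g 4 ∧ g 4 ≤ d 4) ∨ (d 4 ≤ g 4 ∧ g 4 ≤ 0)) ∧
    ((0 ≤ g 5 ∧ g 5 ≤ d 5) ∨ (d 5 ≤ g 5 ∧ g 5 ≤ 0)) := by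
  simp [Conformal, Fin.forall_fin_succ]

/-- Every non-zero kernel vector has a conformal part in the Graver basis; the signs of the
entries at the edges `ab, ac, bc` tell which one. -/
theorem exists_graver_conformal {d : Fin 6 → ℤ} (hd : d ∈ moves triangle) (h0 : d ≠ 0) :
    ∃ a, Conformal (graver a) d := by
  rw [mem_moves_triangle_iff] at hd
  obtain ⟨h1, h2, h3⟩ := hd
  have hne : ¬ (d 1 = 0 ∧ d 2 = 0 ∧ d 4 = 0) := by
    rintro ⟨ha, hb, hc⟩
    apply h0
    ext j
    fin_cases j <;> simp <;> omega
  simp only [conformal_iff]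
  rcases lt_trichotomy (d 1) 0 with hp | hp | hp <;>
  rcases lt_trichotomy (d 2) 0 with hq | hq | hq <;>
  rcases lt_trichotomy (d 4) 0 with hr | hr | hr
  · exact ⟨9, by simp [graver, kerVec]; omega⟩
  · exact ⟨3, by simp [graver, kerVec]; omega⟩
  · exact ⟨0, by simp [graver, kerVec]; omega⟩
  · exact ⟨3, by simp [graver, kerVec]; omega⟩
  · exact ⟨3, by simp [graver, kerVec]; omega⟩
  · exact ⟨7, by simp [graver, kerVec]; omega⟩
  · exact ⟨1, by simp [graver, kerVec]; omega⟩
  · exact ⟨8, by simp [graver, kerVec]; omega⟩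
  · exact ⟨12, by simp [graver, kerVec]; omega⟩
  · exact ⟨4, by simp [graver, kerVec]; omega⟩
  · exact ⟨4, by simp [graver, kerVec]; omega⟩
  · exact ⟨6, by simp [graver, kerVec]; omega⟩
  · exact ⟨5, by simp [graver, kerVec]; omega⟩
  · exact absurd ⟨hp, hq, hr⟩ hne
  · exact ⟨15, by simp [graver, kerVec]; omega⟩
  · exact ⟨16, by simp [graver, kerVec]; omega⟩
  · exact ⟨14, by simp [graver, kerVec]; omega⟩
  · exact ⟨14, by simp [graver, kerVec]; omega⟩
  · exact ⟨2, by simp [graver, kerVec]; omega⟩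
  · exact ⟨18, by simp [graver, kerVec]; omega⟩
  · exact ⟨11, by simp [graver, kerVec]; omega⟩
  · exact ⟨17, by simp [graver, kerVec]; omega⟩
  · exact ⟨13, by simp [graver, kerVec]; omega⟩
  · exact ⟨13, by simp [graver, kerVec]; omega⟩
  · exact ⟨10, by simp [graver, kerVec]; omega⟩
  · exact ⟨13, by simp [graver, kerVec]; omega⟩
  · exact ⟨19, by simp [graver, kerVec]; omega⟩

theorem graver_ne_zero (a : Fin 20) : graver a ≠ 0 := by
  revert a
  decide

/-- Every kernel vector is a conformal sum of elements of the Graver basis. Conformality of the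
whole sum is recorded as the absence of cancellation in the absolute values. -/
theorem exists_graver_decomposition {d : Fin 6 → ℤ} (hd : d ∈ moves triangle) :
    ∃ l : List (Fin 20), (∀ j, (l.map fun a => graver a j).sum = d j) ∧
      (∀ j, (l.map fun a => |graver a j|).sum = |d j|) ∧ ∀ a ∈ l, Conformal (graver a) d := by
  induction hn : (∑ j, (d j).natAbs) using Nat.strong_induction_on generalizing d with
  | _ n ih =>
    by_cases h0 : d = 0
    · exact ⟨[], by simp [h0]⟩
    obtain ⟨a, ha⟩ := exists_graver_conformal hd h0
    have hlt : ∑ j, ((d - graver a) j).natAbs < n := by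
      rw [← hn]
      obtain ⟨j, hj⟩ := Function.ne_iff.mp (graver_ne_zero a)
      refine Finset.sum_lt_sum (fun i _ => ?_) ⟨j, Finset.mem_univ _, ?_⟩
      · have := ha i
        simp only [Pi.sub_apply]
        omega
      · have := ha j
        simp only [Pi.sub_apply, Pi.zero_apply] at *
        omega
    obtain ⟨l, hl1, hl2, hl3⟩ := ih _ hlt (sub_mem_moves_triangle hd (graver_mem_moves a)) rfl
    refine ⟨a :: l, fun j => ?_, fun j => ?_, fun c hc => ?_⟩
    · simp [hl1 j]
    · have := ha j
      simp only [List.map_cons, List.sum_cons, hl2 j, Pi.sub_apply]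
      rcases this with h | h
      · rw [abs_of_nonneg h.1, abs_of_nonneg (by omega), abs_of_nonneg (by omega)]
        ring
      · rw [abs_of_nonpos h.2, abs_of_nonpos (by omega), abs_of_nonpos (by omega)]
        ring
    · rcases List.mem_cons.mp hc with rfl | hc
      · exact ha
      · intro j
        have h1 := ha j
        have h2 := hl3 c hc j
        simp only [Pi.sub_apply] at h2
        omega

/-! ### Fibers and moves of Lawrence liftings -/

section Lawrence

variable {d n : Type*} [Fintype n] [DecidableEq n] (A : Matrix d n ℤ) (N : ℕ)

theorem lawrence_mulVec_inl (z : n × Fin N → ℤ) (i : d) (k : Fin N) :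
    (lawrence A N *ᵥ z) (Sum.inl (i, k)) = (A *ᵥ layer z k) i := by
  simp [lawrence, Matrix.mulVec, dotProduct, Fintype.sum_prod_type, Matrix.blockDiagonal_apply,
    layer]

theorem lawrence_mulVec_inr (z : n × Fin N → ℤ) (j : n) :
    (lawrence A N *ᵥ z) (Sum.inr j) = ∑ k, z (j, k) := by
  simp only [lawrence, Matrix.mulVec, dotProduct, Fintype.sum_prod_type, Matrix.fromRows_apply_inr,
    Matrix.of_apply, ite_mul, one_mul, zero_mul]
  rw [Finset.sum_eq_single j] <;> simp +contextual [eq_comm]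

theorem mem_moves_lawrence_iff (z : n × Fin N → ℤ) : z ∈ moves (lawrence A N) ↔
    (∀ k, layer z k ∈ moves A) ∧ ∀ j, ∑ k, z (j, k) = 0 := by
  simp only [moves, Set.mem_ofPred_eq, funext_iff, Sum.forall, Prod.forall, lawrence_mulVec_inl,
    lawrence_mulVec_inr, Pi.zero_apply]
  rw [forall_comm]

end Lawrence

section Steps

variable {d n : Type*} [Fintype n] {A : Matrix d n ℤ} {M : Set (n → ℤ)} {b : d → ℤ}

theorem Step.symm {x y : n → ℕ} (h : Step A M b x y) : Step A M b y x :=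
  ⟨h.2.1, h.1, h.2.2.symm⟩

theorem sub_mem_moves_of_mem_fiber {x y : n → ℕ} (hx : x ∈ fiber A b) (hy : y ∈ fiber A b) :
    (fun j => (y j : ℤ) - (x j : ℤ)) ∈ moves A := by
  have h : (fun j => (y j : ℤ) - (x j : ℤ)) = (fun j => (y j : ℤ)) - fun j => (x j : ℤ) := rfl
  simp only [moves, fiber, Set.mem_ofPred_eq] at *
  rw [h, Matrix.mulVec_sub, hx, hy, sub_self]

/-- Adding a move in `M` leads to a neighbour in the fiber, provided that no entry gets
negative. -/
theorem step_toNat_add {x : n → ℕ} (hx : x ∈ fiber A b) {w : n → ℤ} (hw : w ∈ moves A)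
    (hM : w ∈ M) (hnn : ∀ j, 0 ≤ (x j : ℤ) + w j) :
    Step A M b x (fun j => ((x j : ℤ) + w j).toNat) := by
  have h : (fun j => ((((x j : ℤ) + w j).toNat : ℕ) : ℤ)) = (fun j => (x j : ℤ)) + w :=
    funext fun j => Int.toNat_of_nonneg (hnn j)
  refine ⟨hx, ?_, Or.inl ?_⟩
  · simp only [moves, fiber, Set.mem_ofPred_eq] at *
    rw [h, Matrix.mulVec_add, hx, hw, add_zero]
  · convert hM using 1
    ext j
    have := congrFun h j
    simp only [Pi.add_apply] at this
    rw [this]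
    ring

end Steps

/-! ### Steps that shorten the pieces of a difference -/

/-- The 1-distance of two points of a fiber. -/
def fiberDist {n : Type*} [Fintype n] (x y : n → ℕ) : ℕ :=
  ∑ j, ((y j : ℤ) - (x j : ℤ)).natAbs

theorem fiberDist_comm {n : Type*} [Fintype n] (x y : n → ℕ) : fiberDist x y = fiberDist y x :=
  Finset.sum_congr rfl fun j _ => by omega

/-- The moves of type at most `m` for a Lawrence lifting of the triangle. -/
abbrev movesOfType (N m : ℕ) : Set (Fin 6 × Fin N → ℤ) :=
  {z | z ∈ moves (lawrence triangle N) ∧ moveType z ≤ m}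

/-- Let the layers of `y - x` be written as conformal sums of pieces `g i`. Changing `x` by `δ i`
at the piece `i`, for the few `i` with `δ i ≠ 0`, is a step in the fiber if the `δ i` are kernel
vectors with sum zero that keep the negative part of each piece non-negative. It comes closer to
`y` if it makes the pieces shorter. -/
theorem exists_step_of_pieces {N m : ℕ} {B : (Fin 3 × Fin N) ⊕ Fin 6 → ℤ}
    {x y : Fin 6 × Fin N → ℕ} (hx : x ∈ fiber (lawrence triangle N) B)
    {I : Fin N → Type} [∀ k, Fintype (I k)] (g δ : (Σ k, I k) → Fin 6 → ℤ)
    (hg : ∀ k j, ∑ i, g ⟨k, i⟩ j = (y (j, k) : ℤ) - x (j, k))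
    (hc : ∀ k j, ∑ i, |g ⟨k, i⟩ j| = |(y (j, k) : ℤ) - x (j, k)|)
    (S : Finset (Σ k, I k)) (hS : S.card ≤ m) (hδS : ∀ i, i ∉ S → δ i = 0)
    (hδ : ∀ i, δ i ∈ moves triangle) (hsum : ∀ j, ∑ i, δ i j = 0)
    (hnn : ∀ i j, 0 ≤ δ i j ∨ g i j ≤ δ i j)
    (hlt : ∑ i, ∑ j, |g i j - δ i j| < ∑ i, ∑ j, |g i j|) :
    ∃ x', Step (lawrence triangle N) (movesOfType N m) B x x' ∧
      fiberDist x' y < fiberDist x y := by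
  classical
  set w : Fin 6 × Fin N → ℤ := fun p => ∑ i, δ ⟨p.2, i⟩ p.1 with hw
  have hlayer : ∀ k, layer w k = ∑ i, δ ⟨k, i⟩ := fun k => by
    ext j
    simp [layer, hw]
  have hwm : w ∈ moves (lawrence triangle N) := by
    rw [mem_moves_lawrence_iff]
    refine ⟨fun k => ?_, fun j => ?_⟩
    · rw [hlayer]
      simp only [moves, Set.mem_ofPred_eq]
      rw [Matrix.mulVec_sum]
      exact Finset.sum_eq_zero fun i _ => hδ _
    · rw [← hsum j, Fintype.sum_sigma]
  have htype : moveType w ≤ m := by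
    refine (Finset.card_le_card (t := S.image Sigma.fst) fun k hk => ?_).trans
      (Finset.card_image_le.trans hS)
    simp only [Finset.mem_filter, Finset.mem_univ, true_and] at hk
    rw [hlayer] at hk
    obtain ⟨i, -, hi⟩ := Finset.exists_ne_zero_of_sum_ne_zero hk
    exact Finset.mem_image.mpr ⟨⟨k, i⟩, by_contra fun h => hi (hδS _ h), rfl⟩
  have hpos : ∀ p, 0 ≤ (x p : ℤ) + w p := by
    rintro ⟨j, k⟩
    -- without cancellation, the negative parts of the pieces add up to that of `y - x`
    have h1 : ∑ i, (|g ⟨k, i⟩ j| - g ⟨k, i⟩ j) ≤ 2 * x (j, k) := by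
      rw [Finset.sum_sub_distrib, hc, hg]
      rcases abs_cases ((y (j, k) : ℤ) - x (j, k)) with h | h <;> omega
    have h2 : -(2 * w (j, k)) ≤ ∑ i, (|g ⟨k, i⟩ j| - g ⟨k, i⟩ j) := by
      rw [hw, Finset.mul_sum, ← Finset.sum_neg_distrib]
      refine Finset.sum_le_sum fun i _ => ?_
      have := hnn ⟨k, i⟩ j
      rcases abs_cases (g ⟨k, i⟩ j) with h | h <;> dsimp only <;> omega
    omega
  refine ⟨_, step_toNat_add hx hwm ⟨hwm, htype⟩ hpos, ?_⟩
  zify [fiberDist]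
  have h3 : ∑ p : Fin 6 × Fin N, |(y p : ℤ) - x p| = ∑ i, ∑ j, |g i j| := by
    rw [Fintype.sum_prod_type_right, Fintype.sum_sigma]
    refine Finset.sum_congr rfl fun k _ => ?_
    rw [Finset.sum_comm]
    exact Finset.sum_congr rfl fun j _ => (hc k j).symm
  have h4 : ∑ p : Fin 6 × Fin N, |(y p : ℤ) - ((((x p : ℤ) + w p).toNat : ℕ) : ℤ)| ≤
      ∑ i, ∑ j, |g i j - δ i j| := by
    rw [Fintype.sum_prod_type_right, Fintype.sum_sigma]
    refine Finset.sum_le_sum fun k _ => ?_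
    rw [Finset.sum_comm]
    refine Finset.sum_le_sum fun j _ => ?_
    rw [Int.toNat_of_nonneg (hpos _)]
    have : (y (j, k) : ℤ) - ((x (j, k) : ℤ) + w (j, k)) =
        ∑ i, (g ⟨k, i⟩ j - δ ⟨k, i⟩ j) := by
      rw [Finset.sum_sub_distrib, hg]
      ring
    rw [this]
    exact Finset.abs_sum_le_sum_abs _ _
  omega

/-- Replacing the pieces `p t` by `p t - q t` (names of elements of the Graver basis) is a zero-sum
change of the negative parts of the pieces that makes the pieces shorter. -/
def Improves {m : ℕ} (p q : Fin m → Fin 20) : Prop :=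
  (∀ j, ∑ t, graver (q t) j = 0) ∧
  (∀ t j, 0 ≤ graver (q t) j ∨ graver (p t) j ≤ graver (q t) j) ∧
  ∑ t, ∑ j, (graver (p t) j - graver (q t) j).natAbs < ∑ t, ∑ j, (graver (p t) j).natAbs

instance {m : ℕ} (p q : Fin m → Fin 20) : Decidable (Improves p q) := by
  unfold Improves
  infer_instance

/-- A labelled family `p` embeds into a labelled family `a` that has each label at least as often. -/
theorem exists_injective_of_card_le {ι κ L : Type*} [Fintype ι] [Fintype κ] [DecidableEq L]
    (p : κ → L) (a : ι → L) (h : ∀ t, (Finset.univ.filter fun t' => p t' = p t).card ≤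
      (Finset.univ.filter fun i => a i = p t).card) :
    ∃ s : κ → ι, Function.Injective s ∧ ∀ t, a (s t) = p t := by
  have hemb : ∀ c : L, Nonempty ({t' // p t' = c} ↪ {i // a i = c}) := fun c => by
    by_cases hc : ∃ t, p t = c
    · obtain ⟨t, rfl⟩ := hc
      exact Function.Embedding.nonempty_of_card_le (by simpa [Fintype.card_subtype] using h t)
    · have : IsEmpty {t' // p t' = c} := ⟨fun t => hc ⟨t.1, t.2⟩⟩
      exact ⟨Function.Embedding.ofIsEmpty⟩
  let f := fun c => (hemb c).some
  refine ⟨fun t => (f (p t) ⟨t, rfl⟩).1, fun t t' htt => ?_, fun t => (f (p t) ⟨t, rfl⟩).2⟩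
  have hp : p t = p t' := by
    rw [← (f (p t) ⟨t, rfl⟩).2, ← (f (p t') ⟨t', rfl⟩).2]
    exact congrArg a htt
  have key : ∀ (c : L) (hc : p t = c) (hc' : p t' = c),
      (f c ⟨t, hc⟩).1 = (f c ⟨t', hc'⟩).1 → t = t' := fun c hc hc' h =>
    congrArg Subtype.val ((f c).injective (Subtype.ext h))
  have hcast : ∀ (c c' : L) (hc : p t' = c) (hc' : p t' = c'),
      (f c ⟨t', hc⟩).1 = (f c' ⟨t', hc'⟩).1 := by
    rintro _ _ rfl rfl
    rfl
  exact key (p t) rfl hp.symm (htt.trans (hcast _ _ _ _))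

/-- An improving pattern among the pieces of `y - x` yields a step from `x` towards `y`. -/
theorem exists_step_of_improves {N m M : ℕ} (hm : m ≤ M) {B : (Fin 3 × Fin N) ⊕ Fin 6 → ℤ}
    {x y : Fin 6 × Fin N → ℕ} (hx : x ∈ fiber (lawrence triangle N) B)
    {I : Fin N → Type} [∀ k, Fintype (I k)] (a : (Σ k, I k) → Fin 20)
    (hg : ∀ k j, ∑ i, graver (a ⟨k, i⟩) j = (y (j, k) : ℤ) - x (j, k))
    (hc : ∀ k j, ∑ i, |graver (a ⟨k, i⟩) j| = |(y (j, k) : ℤ) - x (j, k)|)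
    {p q : Fin m → Fin 20} (hpq : Improves p q)
    (hcard : ∀ t, (Finset.univ.filter fun t' => p t' = p t).card ≤
      (Finset.univ.filter fun i => a i = p t).card) :
    ∃ x', Step (lawrence triangle N) (movesOfType N M) B x x' ∧
      fiberDist x' y < fiberDist x y := by
  classical
  obtain ⟨s, hs, has⟩ := exists_injective_of_card_le p a hcard
  obtain ⟨h1, h2, h3⟩ := hpq
  set δ : (Σ k, I k) → Fin 6 → ℤ := Function.extend s (fun t => graver (q t)) 0 with hδ
  have hδs : ∀ t, δ (s t) = graver (q t) := fun t => hs.extend_apply _ _ _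
  have hδ0 : ∀ i, i ∉ Set.range s → δ i = 0 := fun i hi =>
    Function.extend_apply' _ _ _ fun ⟨t, ht⟩ => hi ⟨t, ht⟩
  refine exists_step_of_pieces hx (fun i => graver (a i)) δ hg hc (Finset.univ.image s)
    (Finset.card_image_le.trans (by simpa using hm)) (fun i hi => hδ0 i (by simpa using hi)) (fun i => ?_)
    (fun j => ?_) (fun i j => ?_) ?_
  · by_cases hi : i ∈ Set.range s
    · obtain ⟨t, rfl⟩ := hi
      rw [hδs]
      exact graver_mem_moves _
    · rw [hδ0 i hi]
      simp [moves]
  · rw [← h1 j]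
    exact (Fintype.sum_of_injective s hs _ _ (fun i hi => by simp [hδ0 i hi])
      (fun t => by rw [hδs])).symm
  · by_cases hi : i ∈ Set.range s
    · obtain ⟨t, rfl⟩ := hi
      rw [hδs, has]
      exact h2 t j
    · left
      simp [hδ0 i hi]
  · zify at h3
    rw [← sub_pos, ← Finset.sum_sub_distrib] at h3 ⊢
    refine h3.trans_eq (Fintype.sum_of_injective s hs _ _ (fun i hi => by simp [hδ0 i hi])
      (fun t => by rw [hδs, has]))

theorem graver_add_ten (a : Fin 20) : graver (a + 10) = -graver a := by
  revert a
  decide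

/-! ### Zero-sum multisets of pieces without clashes -/

/-- Pieces `a` and `b` of `y - x` can be shortened by adding an element of the Graver basis to one
of them and subtracting it from the other one, within the negative parts or within the positive
parts of the pieces. -/
def Clash (a b : Fin 20) : Prop :=
  a ≠ b ∧ ∃ c : Fin 20, Improves ![a, b] ![c, c + 10] ∨ Improves ![a + 10, b + 10] ![c, c + 10]

instance (a b : Fin 20) : Decidable (Clash a b) := by
  unfold Clash
  infer_instance

/-- The arithmetic for the vectors `±e_i` and `±(e_i + e_j)`: with `x` copies of a vector and `y`
copies of its negative, never both present, a non-empty zero-sum multiset has a zero-sum subset of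
size three, four or five of one of the listed shapes. -/
theorem pair_counts_eq_zero {x0 x1 x2 x3 x4 x5 y0 y1 y2 y3 y4 y5 : ℕ}
    (e0 : x0 + x3 + x4 = y0 + y3 + y4) (e1 : x1 + x3 + x5 = y1 + y3 + y5)
    (e2 : x2 + x4 + x5 = y2 + y4 + y5)
    (o0 : x0 = 0 ∨ y0 = 0) (o1 : x1 = 0 ∨ y1 = 0) (o2 : x2 = 0 ∨ y2 = 0)
    (o3 : x3 = 0 ∨ y3 = 0) (o4 : x4 = 0 ∨ y4 = 0) (o5 : x5 = 0 ∨ y5 = 0)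
    (h3 : (x3 = 0 ∨ y0 = 0 ∨ y1 = 0) ∧ (x4 = 0 ∨ y0 = 0 ∨ y2 = 0) ∧ (x5 = 0 ∨ y1 = 0 ∨ y2 = 0) ∧
      (y3 = 0 ∨ x0 = 0 ∨ x1 = 0) ∧ (y4 = 0 ∨ x0 = 0 ∨ x2 = 0) ∧ (y5 = 0 ∨ x1 = 0 ∨ x2 = 0))
    (h4 : (x3 = 0 ∨ y4 = 0 ∨ y1 = 0 ∨ x2 = 0) ∧ (x3 = 0 ∨ y5 = 0 ∨ y0 = 0 ∨ x2 = 0) ∧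
      (x4 = 0 ∨ y3 = 0 ∨ y2 = 0 ∨ x1 = 0) ∧ (x4 = 0 ∨ y5 = 0 ∨ y0 = 0 ∨ x1 = 0) ∧
      (x5 = 0 ∨ y3 = 0 ∨ y2 = 0 ∨ x0 = 0) ∧ (x5 = 0 ∨ y4 = 0 ∨ y1 = 0 ∨ x0 = 0))
    (h5 : (x3 = 0 ∨ y4 = 0 ∨ y5 = 0 ∨ x2 ≤ 1) ∧ (x4 = 0 ∨ y3 = 0 ∨ y5 = 0 ∨ x1 ≤ 1) ∧
      (x5 = 0 ∨ y3 = 0 ∨ y4 = 0 ∨ x0 ≤ 1) ∧ (y3 = 0 ∨ x4 = 0 ∨ x5 = 0 ∨ y2 ≤ 1) ∧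
      (y4 = 0 ∨ x3 = 0 ∨ x5 = 0 ∨ y1 ≤ 1) ∧ (y5 = 0 ∨ x3 = 0 ∨ x4 = 0 ∨ y0 ≤ 1)) :
    x0 = 0 ∧ x1 = 0 ∧ x2 = 0 ∧ x3 = 0 ∧ x4 = 0 ∧ x5 = 0 ∧ y0 = 0 ∧ y1 = 0 ∧ y2 = 0 ∧ y3 = 0 ∧
      y4 = 0 ∧ y5 = 0 := by
  obtain ⟨t1, t2, t3, t4, t5, t6⟩ := h3
  obtain ⟨q1, q2, q3, q4, q5, q6⟩ := h4
  obtain ⟨p1, p2, p3, p4, p5, p6⟩ := h5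
  have hx3 : x3 = 0 := by
    by_contra h
    rcases t1.resolve_left h with h' | h'
    · clear t1 t2 t3 t4 t5 t6 q2 q3 q4 q5 q6 p2 p3 p4 p6
      omega
    · clear t1 t2 t3 t4 t5 t6 q1 q3 q4 q5 q6 p2 p3 p4 p5
      omega
  have hy3 : y3 = 0 := by
    by_contra h
    rcases t4.resolve_left h with h' | h'
    · clear t1 t2 t3 t4 t5 t6 q1 q2 q4 q5 q6 p1 p3 p5 p6
      omega
    · clear t1 t2 t3 t4 t5 t6 q1 q2 q3 q4 q6 p1 p2 p5 p6
      omega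
  have hx4 : x4 = 0 := by
    clear t1 t3 t4 t5 t6 q1 q2 q3 q5 q6 p1 p2 p3 p4 p5 p6
    omega
  have hy4 : y4 = 0 := by
    clear t1 t2 t3 t4 t6 q1 q2 q3 q4 q5 p1 p2 p3 p4 p5 p6
    omega
  clear t1 t2 t4 t5 q1 q2 q3 q4 q5 q6 p1 p2 p3 p4 p5 p6
  omega

/-- The zero-sum triples of shape `(e_i + e_j) - e_i - e_j`, up to sign. -/
def zeroSumTriples : List (Fin 3 → Fin 20) :=
  [![3, 10, 11], ![4, 10, 12], ![5, 11, 12], ![13, 0, 1], ![14, 0, 2], ![15, 1, 2]]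

/-- The zero-sum quadruples of shape `(e_i + e_j) - (e_i + e_k) - e_j + e_k`. -/
def zeroSumQuadruples : List (Fin 4 → Fin 20) :=
  [![3, 14, 11, 2], ![3, 15, 10, 2], ![4, 13, 12, 1], ![4, 15, 10, 1], ![5, 13, 12, 0],
    ![5, 14, 11, 0]]

/-- The zero-sum quintuples of shape `(e_i + e_j) - (e_i + e_k) - (e_j + e_k) + 2 e_k`, up to sign.
The layers of `fiveLayers` are one of them. -/
def zeroSumQuintuples : List (Fin 5 → Fin 20) :=
  [![3, 14, 15, 2, 2], ![4, 13, 15, 1, 1], ![5, 13, 14, 0, 0], ![13, 4, 5, 12, 12],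
    ![14, 3, 5, 11, 11], ![15, 3, 4, 10, 10]]

theorem improves_of_mem_zeroSumTriples : ∀ t ∈ zeroSumTriples, Improves t t := by
  simp only [zeroSumTriples, List.forall_mem_cons, List.not_mem_nil, false_imp_iff, implies_true,
    and_true]
  decide

theorem improves_of_mem_zeroSumQuadruples : ∀ t ∈ zeroSumQuadruples, Improves t t := by
  simp only [zeroSumQuadruples, List.forall_mem_cons, List.not_mem_nil, false_imp_iff, implies_true,
    and_true]
  decide

theorem improves_of_mem_zeroSumQuintuples : ∀ t ∈ zeroSumQuintuples, Improves t t := by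
  simp only [zeroSumQuintuples, List.forall_mem_cons, List.not_mem_nil, false_imp_iff, implies_true,
    and_true]
  decide

/-- A zero-sum multiset of elements of the Graver basis, `n c` copies of `c`, is empty if no two of
its elements clash and if it contains none of the listed zero-sum triples, quadruples and
quintuples. An element `±(e_i - e_j)` or `±(1, 1, 1)` cannot occur, since the elements that do not
clash with it lie on one side of a plane through the origin, with that element off the plane. -/
theorem counts_eq_zero (n : Fin 20 → ℕ) (hsum : ∀ j, ∑ c, (n c : ℤ) * graver c j = 0)
    (hpair : ∀ a b, Clash a b → n a = 0 ∨ n b = 0)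
    (h3 : ∀ t ∈ zeroSumTriples, ∃ s, n (t s) = 0)
    (h4 : ∀ t ∈ zeroSumQuadruples, ∃ s, n (t s) = 0)
    (h5 : ∀ t ∈ zeroSumQuintuples, ∃ s, n (t s) < if s ≤ 2 then 1 else 2) :
    ∀ c, n c = 0 := by
  have e1 := hsum 0
  have e2 := hsum 3
  have e3 := hsum 5
  simp only [Fin.sum_univ_succ, graver, kerVec] at e1 e2 e3
  simp at e1 e2 e3
  have z9 : n 9 = 0 := by
    by_contra h
    have c : ∀ b ∈ ([10, 11, 12, 13, 14, 15, 19] : List (Fin 20)), Clash 9 b := by decide +kernel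
    have z : ∀ b ∈ ([10, 11, 12, 13, 14, 15, 19] : List (Fin 20)), n b = 0 :=
      fun b hb => (hpair 9 b (c b hb)).resolve_left h
    simp at z
    omega
  have z19 : n 19 = 0 := by
    by_contra h
    have c : ∀ b ∈ ([0, 1, 2, 3, 4, 5] : List (Fin 20)), Clash 19 b := by decide +kernel
    have z : ∀ b ∈ ([0, 1, 2, 3, 4, 5] : List (Fin 20)), n b = 0 :=
      fun b hb => (hpair 19 b (c b hb)).resolve_left h
    simp at z
    omega
  have z6 : n 6 = 0 := by
    by_contra h
    have c : ∀ b ∈ ([1, 5, 8, 10, 14, 16, 17] : List (Fin 20)), Clash 6 b := by decide +kernel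
    have z : ∀ b ∈ ([1, 5, 8, 10, 14, 16, 17] : List (Fin 20)), n b = 0 :=
      fun b hb => (hpair 6 b (c b hb)).resolve_left h
    simp at z
    omega
  have z7 : n 7 = 0 := by
    by_contra h
    have c : ∀ b ∈ ([2, 5, 10, 13, 16, 17, 18] : List (Fin 20)), Clash 7 b := by decide +kernel
    have z : ∀ b ∈ ([2, 5, 10, 13, 16, 17, 18] : List (Fin 20)), n b = 0 :=
      fun b hb => (hpair 7 b (c b hb)).resolve_left h
    simp at z
    omega
  have z8 : n 8 = 0 := by
    by_contra h
    have c : ∀ b ∈ ([2, 4, 6, 11, 13, 17, 18] : List (Fin 20)), Clash 8 b := by decide +kernel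
    have z : ∀ b ∈ ([2, 4, 6, 11, 13, 17, 18] : List (Fin 20)), n b = 0 :=
      fun b hb => (hpair 8 b (c b hb)).resolve_left h
    simp at z
    omega
  have z16 : n 16 = 0 := by
    by_contra h
    have c : ∀ b ∈ ([0, 4, 6, 7, 11, 15, 18] : List (Fin 20)), Clash 16 b := by decide +kernel
    have z : ∀ b ∈ ([0, 4, 6, 7, 11, 15, 18] : List (Fin 20)), n b = 0 :=
      fun b hb => (hpair 16 b (c b hb)).resolve_left h
    simp at z
    omega
  have z17 : n 17 = 0 := by
    by_contra h
    have c : ∀ b ∈ ([0, 3, 6, 7, 8, 12, 15] : List (Fin 20)), Clash 17 b := by decide +kernel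
    have z : ∀ b ∈ ([0, 3, 6, 7, 8, 12, 15] : List (Fin 20)), n b = 0 :=
      fun b hb => (hpair 17 b (c b hb)).resolve_left h
    simp at z
    omega
  have z18 : n 18 = 0 := by
    by_contra h
    have c : ∀ b ∈ ([1, 3, 7, 8, 12, 14, 16] : List (Fin 20)), Clash 18 b := by decide +kernel
    have z : ∀ b ∈ ([1, 3, 7, 8, 12, 14, 16] : List (Fin 20)), n b = 0 :=
      fun b hb => (hpair 18 b (c b hb)).resolve_left h
    simp at z
    omega
  simp [zeroSumTriples, zeroSumQuadruples, zeroSumQuintuples, Fin.exists_fin_succ] at h3 h4 h5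
  have o0 := hpair 0 10 (by decide +kernel)
  have o1 := hpair 1 11 (by decide +kernel)
  have o2 := hpair 2 12 (by decide +kernel)
  have o3 := hpair 3 13 (by decide +kernel)
  have o4 := hpair 4 14 (by decide +kernel)
  have o5 := hpair 5 15 (by decide +kernel)
  have key := pair_counts_eq_zero (x0 := n 0) (x1 := n 1) (x2 := n 2) (x3 := n 3) (x4 := n 4)
    (x5 := n 5) (y0 := n 10) (y1 := n 11) (y2 := n 12) (y3 := n 13) (y4 := n 14) (y5 := n 15)
    (by omega) (by omega) (by omega) o0 o1 o2 o3 o4 o5 h3 h4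
    (by clear h3 h4 hsum hpair e1 e2 e3 o0 o1 o2 o3 o4 o5; omega)
  intro c
  fin_cases c <;> simp <;> omega

/-! ### The upper bound for the Markov complexity -/

/-- Two different points of a fiber of a Lawrence lifting of the triangle can be brought closer to
each other by a move of type at most five applied to one of them. -/
theorem exists_closer_step {N : ℕ} {B : (Fin 3 × Fin N) ⊕ Fin 6 → ℤ} {x y : Fin 6 × Fin N → ℕ}
    (hx : x ∈ fiber (lawrence triangle N) B) (hy : y ∈ fiber (lawrence triangle N) B)
    (hxy : x ≠ y) :
    (∃ x', Step (lawrence triangle N) (movesOfType N 5) B x x' ∧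
      fiberDist x' y < fiberDist x y) ∨
    (∃ y', Step (lawrence triangle N) (movesOfType N 5) B y y' ∧
      fiberDist x y' < fiberDist x y) := by
  by_contra hno
  rw [not_or] at hno
  obtain ⟨hno1, hno2⟩ := hno
  have hz := (mem_moves_lawrence_iff _ _ _).mp (sub_mem_moves_of_mem_fiber hx hy)
  choose l hl1 hl2 _ using fun k => exists_graver_decomposition (hz.1 k)
  let a : (Σ k, Fin (l k).length) → Fin 20 := fun i => (l i.1)[i.2]
  have hg : ∀ k j, ∑ i, graver (a ⟨k, i⟩) j = (y (j, k) : ℤ) - x (j, k) := fun k j =>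
    (Fin.sum_univ_fun_getElem (l k) (fun c => graver c j)).trans (hl1 k j)
  have hc : ∀ k j, ∑ i, |graver (a ⟨k, i⟩) j| = |(y (j, k) : ℤ) - x (j, k)| := fun k j =>
    (Fin.sum_univ_fun_getElem (l k) (fun c => |graver c j|)).trans (hl2 k j)
  -- `n c` is the number of pieces `c` in all layers together
  set n : Fin 20 → ℕ := fun c => (Finset.univ.filter fun i => a i = c).card with hn
  have himp : ∀ {m : ℕ} (_ : m ≤ 5) (p q : Fin m → Fin 20),
      (Improves p q ∨ Improves (fun t => p t + 10) q) →
      ¬ ∀ t, (Finset.univ.filter fun t' => p t' = p t).card ≤ n (p t) := by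
    rintro m hm p q (h | h) hcard
    · exact hno1 (exists_step_of_improves hm hx a hg hc h hcard)
    · -- exchanging `x` and `y` turns each piece into its negative
      obtain ⟨y', h1, h2⟩ := exists_step_of_improves (y := x) hm hy (fun i => a i + 10)
        (fun k j => by
          simp only [graver_add_ten, Pi.neg_apply, Finset.sum_neg_distrib, hg]
          ring)
        (fun k j => by
          simp only [graver_add_ten, Pi.neg_apply, abs_neg, hc]
          exact abs_sub_comm _ _) h
        (fun t => by simpa only [add_left_inj] using hcard t)
      exact hno2 ⟨y', h1, by rwa [fiberDist_comm x y', fiberDist_comm x y]⟩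
  have hpair : ∀ b c, Clash b c → n b = 0 ∨ n c = 0 := by
    rintro b c ⟨hbc, d, hd⟩
    by_contra h
    rw [not_or] at h
    refine himp (by norm_num) ![b, c] ![d, d + 10] (hd.imp id fun h => ?_) ?_
    · convert h using 1
      ext t
      fin_cases t <;> rfl
    · intro t
      fin_cases t
      · simp [Fin.univ_succ, Finset.filter_insert, Finset.filter_singleton, hbc.symm]
        omega
      · simp [Fin.univ_succ, Finset.filter_insert, Finset.filter_singleton, hbc]
        omega
  -- a zero-sum set of at most five pieces could be added to `x` as a whole
  have hzero : ∀ {m : ℕ} (_ : m ≤ 5) (p : Fin m → Fin 20), Improves p p →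
      ∃ t, n (p t) < (Finset.univ.filter fun t' => p t' = p t).card := fun hm p hp => by
    simpa using himp hm p p (Or.inl hp)
  have hsum : ∀ j, ∑ c, (n c : ℤ) * graver c j = 0 := by
    intro j
    rw [← hz.2 j, ← Finset.sum_congr rfl fun k _ => hg k j, ← Fintype.sum_sigma',
      ← Finset.sum_fiberwise (s := Finset.univ) (g := a)]
    refine Finset.sum_congr rfl fun c _ => ?_
    rw [Finset.sum_congr rfl (g := fun _ => graver c j) (fun i hi => by
      rw [(Finset.mem_filter.mp hi).2])]
    simp [hn]
  have hall : ∀ c, n c = 0 := by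
    refine counts_eq_zero n hsum hpair (fun t ht => ?_) (fun t ht => ?_) (fun t ht => ?_)
    · obtain ⟨s, hs⟩ := hzero (by norm_num) t (improves_of_mem_zeroSumTriples t ht)
      have hcard : ∀ t ∈ zeroSumTriples, ∀ s,
          (Finset.univ.filter fun t' => t t' = t s).card = 1 := by
        simp only [zeroSumTriples, List.forall_mem_cons, List.not_mem_nil, false_imp_iff,
          implies_true, and_true]
        decide
      exact ⟨s, by have := hcard t ht s; omega⟩
    · obtain ⟨s, hs⟩ := hzero (by norm_num) t (improves_of_mem_zeroSumQuadruples t ht)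
      have hcard : ∀ t ∈ zeroSumQuadruples, ∀ s,
          (Finset.univ.filter fun t' => t t' = t s).card = 1 := by
        simp only [zeroSumQuadruples, List.forall_mem_cons, List.not_mem_nil, false_imp_iff,
          implies_true, and_true]
        decide
      exact ⟨s, by have := hcard t ht s; omega⟩
    · obtain ⟨s, hs⟩ := hzero le_rfl t (improves_of_mem_zeroSumQuintuples t ht)
      have hcard : ∀ t ∈ zeroSumQuintuples, ∀ s,
          (Finset.univ.filter fun t' => t t' = t s).card = if s ≤ 2 then 1 else 2 := by
        simp only [zeroSumQuintuples, List.forall_mem_cons, List.not_mem_nil, false_imp_iff,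
          implies_true, and_true]
        decide
      exact ⟨s, hcard t ht s ▸ hs⟩
  refine hxy (funext fun jk => ?_)
  obtain ⟨j, k⟩ := jk
  have h0 : ∀ i : Fin (l k).length, False := fun i => by
    have := Finset.card_eq_zero.mp (hall (a ⟨k, i⟩))
    have hmem : (⟨k, i⟩ : Σ k, Fin (l k).length) ∈
        Finset.univ.filter fun i' => a i' = a ⟨k, i⟩ := by simp
    rw [this] at hmem
    exact Finset.notMem_empty _ hmem
  have := hg k j
  rw [Finset.sum_eq_zero fun i _ => (h0 i).elim] at this
  omega

theorem isMarkovBasis_movesOfType_five (N : ℕ) :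
    IsMarkovBasis (lawrence triangle N) (movesOfType N 5) := by
  refine ⟨fun z hz => hz.1, fun B x hx y hy => ?_⟩
  induction hD : fiberDist x y using Nat.strong_induction_on generalizing x y with
  | _ D ih =>
    by_cases hxy : x = y
    · rw [hxy]
    rcases exists_closer_step hx hy hxy with ⟨x', h1, h2⟩ | ⟨y', h1, h2⟩
    · exact .head h1 (ih _ (hD ▸ h2) x' h1.2.1 y hy rfl)
    · exact .tail (ih _ (hD ▸ h2) x hx y' h1.2.1 rfl) h1.symm

/-! ### The indispensable move of type five -/

/-- The fiber of each layer of `fiveLayers` consists of the positive and the negative part. -/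
theorem eq_or_eq_of_mem_fiber_layer (k : Fin 5) (x : Fin 6 → ℕ)
    (hx : x ∈ fiber triangle (triangle *ᵥ fun j => ((fiveLayers (j, k)).toNat : ℤ))) :
    x = (fun j => (fiveLayers (j, k)).toNat) ∨ x = fun j => (-fiveLayers (j, k)).toNat := by
  simp only [fiber, Set.mem_ofPred_eq, triangle_mulVec] at hx
  simp only [funext_iff, Fin.forall_fin_succ]
  fin_cases k <;> simp [fiveLayers] at hx ⊢ <;> omega

/-- No proper non-empty subset of the five layers has sum zero. -/
theorem fiveLayers_choice (e : Fin 5 → Bool)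
    (he : ∀ j, ∑ k, (if e k then (fiveLayers (j, k)).toNat else (-fiveLayers (j, k)).toNat) =
      ∑ k, (fiveLayers (j, k)).toNat) : (∀ k, e k = true) ∨ ∀ k, e k = false := by
  revert e
  decide

theorem mem_fiber_lawrence_iff {d n : Type*} [Fintype n] [DecidableEq n] (A : Matrix d n ℤ) (N : ℕ)
    (x w : n × Fin N → ℕ) :
    x ∈ fiber (lawrence A N) (lawrence A N *ᵥ fun p => (w p : ℤ)) ↔
      (∀ k, (fun j => x (j, k)) ∈ fiber A (A *ᵥ fun j => (w (j, k) : ℤ))) ∧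
        ∀ j, ∑ k, x (j, k) = ∑ k, w (j, k) := by
  simp only [fiber, Set.mem_ofPred_eq, funext_iff, Sum.forall, Prod.forall, lawrence_mulVec_inl,
    lawrence_mulVec_inr]
  rw [forall_comm]
  exact and_congr Iff.rfl (forall_congr' fun j => by norm_cast)

theorem fiveLayers_isIndispensable : IsIndispensable (lawrence triangle 5) fiveLayers := by
  have hmoves : fiveLayers ∈ moves (lawrence triangle 5) := by
    rw [mem_moves_lawrence_iff]
    simp only [mem_moves_triangle_iff, layer]
    decide
  refine ⟨hmoves, fun h => absurd (congrFun h (0, 0)) (by decide), ?_⟩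
  ext x
  rw [mem_fiber_lawrence_iff]
  constructor
  · rintro ⟨h1, h2⟩
    have h3 := fun k => eq_or_eq_of_mem_fiber_layer k _ (h1 k)
    classical
    have h4 : ∀ j k, x (j, k) =
        if decide ((fun j => x (j, k)) = fun j => (fiveLayers (j, k)).toNat) then
          (fiveLayers (j, k)).toNat else (-fiveLayers (j, k)).toNat := by
      intro j k
      split_ifs with h
      · exact congrFun (of_decide_eq_true h) j
      · exact congrFun ((h3 k).resolve_left fun h' => h (decide_eq_true h')) j
    rcases fiveLayers_choice
      (fun k => decide ((fun j => x (j, k)) = fun j => (fiveLayers (j, k)).toNat))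
      (fun j => by rw [← h2 j]; exact Finset.sum_congr rfl fun k _ => (h4 j k).symm) with h | h
    · left
      ext ⟨j, k⟩
      rw [h4 j k, if_pos (h k)]
    · right
      ext ⟨j, k⟩
      rw [h4 j k, if_neg (by rw [h k]; exact Bool.false_ne_true)]
  · rintro (rfl | rfl)
    · exact ⟨fun k => rfl, fun j => rfl⟩
    · simp only [fiber, Set.mem_ofPred_eq, triangle_mulVec]
      decide

theorem moveType_fiveLayers : moveType fiveLayers = 5 := by
  decide

theorem moveType_neg {n : Type*} [Fintype n] [DecidableEq n] {N : ℕ} (z : n × Fin N → ℤ) :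
    moveType (-z) = moveType z := by
  refine congrArg Finset.card (Finset.filter_congr fun k _ => not_congr ?_)
  exact neg_eq_zero (a := layer z k)

/-- If `M` connects the fiber of an indispensable move, then it contains that move up to sign. -/
theorem IsIndispensable.mem_or_neg_mem {d n : Type*} [Fintype n] {A : Matrix d n ℤ} {z : n → ℤ}
    (hz : IsIndispensable A z) {M : Set (n → ℤ)} (hM : IsMarkovBasis A M) : z ∈ M ∨ -z ∈ M := by
  obtain ⟨-, hne, hfib⟩ := hz
  have hp : (fun j => (z j).toNat) ∈ fiber A (A *ᵥ fun j => ((z j).toNat : ℤ)) := rfl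
  have hn : (fun j => (-z j).toNat) ∈ fiber A (A *ᵥ fun j => ((z j).toNat : ℤ)) := by
    rw [hfib]
    exact Or.inr rfl
  have hsub : (fun j => (((z j).toNat : ℕ) : ℤ) - (((-z j).toNat : ℕ) : ℤ)) = z :=
    funext fun j => by omega
  have hsub' : (fun j => (((-z j).toNat : ℕ) : ℤ) - (((z j).toNat : ℕ) : ℤ)) = -z :=
    funext fun j => by simp only [Pi.neg_apply]; omega
  by_contra hno
  rw [not_or] at hno
  -- a step from `z⁺` can neither lead to `z⁻`, as `±z ∉ M`, nor elsewhere in the fiber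
  have hstay : ∀ y, Relation.ReflTransGen (Step A M (A *ᵥ fun j => ((z j).toNat : ℤ)))
      (fun j => (z j).toNat) y → y = fun j => (z j).toNat := by
    intro y hy
    induction hy with
    | refl => rfl
    | tail _ hstep ih =>
      subst ih
      have hmem := hstep.2.1
      rw [hfib] at hmem
      rcases hmem with rfl | rfl
      · rfl
      · have := hstep.2.2
        rw [hsub, hsub'] at this
        exact absurd this (by tauto)
  have heq := hstay _ (hM.2 _ _ hp _ hn)
  apply hne
  ext j
  have := congrFun heq j
  simp only [Pi.zero_apply] at *
  omega

theorem markovComplexity_triangle : markovComplexity triangle = 5 := by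
  refine le_antisymm (iInf₂_le_of_le 5 (fun N _ => isMarkovBasis_movesOfType_five N) le_rfl)
    (le_iInf₂ fun m hm => ?_)
  have h : moveType fiveLayers ≤ m := by
    rcases fiveLayers_isIndispensable.mem_or_neg_mem (hm 5 (by norm_num)) with h | h
    · exact h.2
    · rw [← moveType_neg]
      exact h.2
  rw [moveType_fiveLayers] at h
  exact_mod_cast h

/-! ### Quadratic exchanges in multisets of fiber elements -/

section Exchange

variable {b : Fin 3 → ℤ}

/-- Two elements of the multiset `s` are replaced by two elements with the same sum. -/
def QuadStep (s t : Multiset (fiber triangle b)) : Prop :=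
  ∃ u v u' v' w, s = u ::ₘ v ::ₘ w ∧ t = u' ::ₘ v' ::ₘ w ∧ u.1 + v.1 = u'.1 + v'.1

/-- Reachability by quadratic exchanges. -/
abbrev QuadConn (s t : Multiset (fiber triangle b)) : Prop :=
  Relation.ReflTransGen QuadStep s t

/-- The sum of the elements of a multiset of fiber elements. -/
def vecSum (s : Multiset (fiber triangle b)) : Fin 6 → ℕ :=
  (s.map Subtype.val).sum

/-- The sum of the squared 2-norms of the elements, a potential for quadratic exchanges. -/
def energy (s : Multiset (fiber triangle b)) : ℕ :=
  (s.map fun v => ∑ j, v.1 j ^ 2).sum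

/-- No quadratic exchanges lead to a multiset of smaller energy. -/
def EnergyMinimal (s : Multiset (fiber triangle b)) : Prop :=
  ∀ t, QuadConn s t → energy s ≤ energy t

theorem QuadStep.symm {s t : Multiset (fiber triangle b)} (h : QuadStep s t) : QuadStep t s := by
  obtain ⟨u, v, u', v', w, rfl, rfl, h⟩ := h
  exact ⟨u', v', u, v, w, rfl, rfl, h.symm⟩

theorem QuadConn.symm {s t : Multiset (fiber triangle b)} (h : QuadConn s t) : QuadConn t s := by
  have : Std.Symm (QuadStep (b := b)) := ⟨fun _ _ => QuadStep.symm⟩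
  exact Std.Symm.symm _ _ h

theorem QuadConn.cons (a : fiber triangle b) {s t : Multiset (fiber triangle b)}
    (h : QuadConn s t) : QuadConn (a ::ₘ s) (a ::ₘ t) := by
  refine Relation.ReflTransGen.lift (fun s => a ::ₘ s) ?_ _ _ h
  rintro _ _ ⟨u, v, u', v', w, rfl, rfl, h⟩
  refine ⟨u, v, u', v', a ::ₘ w, ?_, ?_, h⟩
  · change a ::ₘ u ::ₘ v ::ₘ w = _
    rw [Multiset.cons_swap a u, Multiset.cons_swap a v]
  · change a ::ₘ u' ::ₘ v' ::ₘ w = _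
    rw [Multiset.cons_swap a u', Multiset.cons_swap a v']

theorem vecSum_cons (a : fiber triangle b) (s : Multiset (fiber triangle b)) :
    vecSum (a ::ₘ s) = a.1 + vecSum s := by
  simp [vecSum]

theorem QuadStep.card_eq_and_vecSum_eq {s t : Multiset (fiber triangle b)} (h : QuadStep s t) :
    s.card = t.card ∧ vecSum s = vecSum t := by
  obtain ⟨u, v, u', v', w, rfl, rfl, h⟩ := h
  simp [vecSum_cons, ← add_assoc, h]

theorem QuadConn.card_eq_and_vecSum_eq {s t : Multiset (fiber triangle b)} (h : QuadConn s t) :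
    s.card = t.card ∧ vecSum s = vecSum t := by
  induction h with
  | refl => exact ⟨rfl, rfl⟩
  | tail _ h ih =>
    exact ⟨ih.1.trans h.card_eq_and_vecSum_eq.1, ih.2.trans h.card_eq_and_vecSum_eq.2⟩

theorem exists_energyMinimal (s : Multiset (fiber triangle b)) :
    ∃ t, QuadConn s t ∧ EnergyMinimal t := by
  obtain ⟨t, ht, hmin⟩ := (measure (energy (b := b))).wf.has_min {t | QuadConn s t} ⟨s, .refl⟩
  exact ⟨t, ht, fun u hu => not_lt.mp (hmin u (ht.trans hu))⟩

theorem fiber_triangle_eqs (v : fiber triangle b) :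
    2 * (v.1 0 : ℤ) + v.1 1 + v.1 2 = b 0 ∧ (v.1 1 : ℤ) + 2 * v.1 3 + v.1 4 = b 1 ∧
      (v.1 2 : ℤ) + v.1 4 + 2 * v.1 5 = b 2 :=
  (triangle_mulVec_eq_iff _ _).mp v.2

/-- An element of the fiber is determined by its loops. -/
theorem fiber_triangle_ext {u v : fiber triangle b} (h0 : u.1 0 = v.1 0) (h3 : u.1 3 = v.1 3)
    (h5 : u.1 5 = v.1 5) : u = v := by
  have hu := fiber_triangle_eqs u
  have hv := fiber_triangle_eqs v
  ext j
  fin_cases j <;> simp <;> omega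

theorem exists_fiber_add (u : fiber triangle b) {K : Fin 6 → ℤ} (hK : K ∈ moves triangle)
    (h : ∀ j, 0 ≤ (u.1 j : ℤ) + K j) :
    ∃ u' : fiber triangle b, ∀ j, (u'.1 j : ℤ) = u.1 j + K j :=
  ⟨⟨_, (step_toNat_add (M := {K}) u.2 hK rfl h).2.1⟩, fun j => Int.toNat_of_nonneg (h j)⟩

theorem neg_mem_moves_triangle {K : Fin 6 → ℤ} (hK : K ∈ moves triangle) : -K ∈ moves triangle := by
  have := sub_mem_moves_triangle (x := 0) (by simp [moves]) hK
  rwa [zero_sub] at this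

theorem exists_quadStep (u v : fiber triangle b) (w : Multiset (fiber triangle b)) {K : Fin 6 → ℤ}
    (hK : K ∈ moves triangle) (hu : ∀ j, 0 ≤ (u.1 j : ℤ) + K j)
    (hv : ∀ j, 0 ≤ (v.1 j : ℤ) - K j) :
    ∃ u' v' : fiber triangle b, (∀ j, (u'.1 j : ℤ) = u.1 j + K j) ∧
      (∀ j, (v'.1 j : ℤ) = v.1 j - K j) ∧ QuadStep (u ::ₘ v ::ₘ w) (u' ::ₘ v' ::ₘ w) := by
  obtain ⟨u', hu'⟩ := exists_fiber_add u hK hu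
  obtain ⟨v', hv'⟩ := exists_fiber_add v (neg_mem_moves_triangle hK) hv
  refine ⟨u', v', hu', hv', u, v, u', v', w, rfl, rfl, funext fun j => ?_⟩
  have h1 := hu' j
  have h2 := hv' j
  simp only [Pi.add_apply, Pi.neg_apply] at *
  omega

theorem energy_cons (a : fiber triangle b) (s : Multiset (fiber triangle b)) :
    energy (a ::ₘ s) = ∑ j, a.1 j ^ 2 + energy s := by
  simp [energy]

/-- The change of the energy by an exchange of the kernel vector `K` is not negative. -/
theorem EnergyMinimal.exchange {s : Multiset (fiber triangle b)} (hs : EnergyMinimal s)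
    {u v : fiber triangle b} (hu : u ∈ s) (hv : v ∈ s) (huv : u ≠ v) {K : Fin 6 → ℤ}
    (hK : K ∈ moves triangle) (hu' : ∀ j, 0 ≤ (u.1 j : ℤ) + K j)
    (hv' : ∀ j, 0 ≤ (v.1 j : ℤ) - K j) :
    0 ≤ ∑ j, K j * ((u.1 j : ℤ) - v.1 j + K j) := by
  obtain ⟨s', rfl⟩ := Multiset.exists_cons_of_mem hu
  obtain ⟨w, rfl⟩ := Multiset.exists_cons_of_mem
    ((Multiset.mem_cons.mp hv).resolve_left huv.symm)
  obtain ⟨x, y, hx, hy, hstep⟩ := exists_quadStep u v w hK hu' hv'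
  have h := hs _ (.single hstep)
  simp only [energy_cons] at h
  zify at h
  simp only [hx, hy] at h
  have hid : (∑ j, ((u.1 j : ℤ) + K j) ^ 2 + (∑ j, ((v.1 j : ℤ) - K j) ^ 2 + energy w)) =
      (∑ j, (u.1 j : ℤ) ^ 2 + (∑ j, (v.1 j : ℤ) ^ 2 + energy w)) +
        2 * ∑ j, K j * ((u.1 j : ℤ) - v.1 j + K j) := by
    simp only [Fin.sum_univ_succ, Finset.univ_eq_empty, Finset.sum_empty]
    ring
  omega

/-- The same for two successive exchanges, of `K` between `u` and `v`, and of `L` between the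
result and `x`. -/
theorem EnergyMinimal.exchange_twice {s : Multiset (fiber triangle b)} (hs : EnergyMinimal s)
    {u v x : fiber triangle b} (hu : u ∈ s) (hv : v ∈ s) (hx : x ∈ s) (huv : u ≠ v) (hux : u ≠ x)
    (hvx : v ≠ x) {K L : Fin 6 → ℤ} (hK : K ∈ moves triangle) (hL : L ∈ moves triangle)
    (h1 : ∀ j, 0 ≤ (u.1 j : ℤ) + K j) (h2 : ∀ j, 0 ≤ (v.1 j : ℤ) - K j)
    (h3 : ∀ j, 0 ≤ (u.1 j : ℤ) + K j + L j) (h4 : ∀ j, 0 ≤ (x.1 j : ℤ) - L j) :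
    0 ≤ ∑ j, (K j * ((u.1 j : ℤ) - v.1 j + K j) + L j * ((u.1 j : ℤ) + K j - x.1 j + L j)) := by
  obtain ⟨s', rfl⟩ := Multiset.exists_cons_of_mem hu
  obtain ⟨s', rfl⟩ := Multiset.exists_cons_of_mem
    ((Multiset.mem_cons.mp hv).resolve_left huv.symm)
  obtain ⟨w, rfl⟩ := Multiset.exists_cons_of_mem ((Multiset.mem_cons.mp
    ((Multiset.mem_cons.mp hx).resolve_left hux.symm)).resolve_left hvx.symm)
  obtain ⟨u', v', hu', hv', hstep⟩ := exists_quadStep u v (x ::ₘ w) hK h1 h2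
  obtain ⟨u'', x', hu'', hx', hstep'⟩ := exists_quadStep u' x (v' ::ₘ w) hL
    (fun j => by rw [hu' j]; exact h3 j) h4
  rw [Multiset.cons_swap x v'] at hstep'
  have h := hs _ (.tail (.single hstep) hstep')
  simp only [energy_cons] at h
  zify at h
  simp only [hu'', hx', hv', hu'] at h
  have hid : (∑ j, ((u.1 j : ℤ) + K j + L j) ^ 2 + (∑ j, ((x.1 j : ℤ) - L j) ^ 2 +
      (∑ j, ((v.1 j : ℤ) - K j) ^ 2 + energy w))) =
      (∑ j, (u.1 j : ℤ) ^ 2 + (∑ j, (v.1 j : ℤ) ^ 2 + (∑ j, (x.1 j : ℤ) ^ 2 + energy w))) +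
        2 * ∑ j, (K j * ((u.1 j : ℤ) - v.1 j + K j) +
          L j * ((u.1 j : ℤ) + K j - x.1 j + L j)) := by
    simp only [Fin.sum_univ_succ, Finset.univ_eq_empty, Finset.sum_empty]
    ring
  omega

/-! ### Multisets of minimal energy lie in a unit cube of loop numbers -/

/-- In a multiset of minimal energy, the numbers of loops at a vertex differ by at most one. If they
differ more for `u` and `v`, some conformal part of `u - v` can be moved from `u` to `v`. -/
theorem EnergyMinimal.loop_le_add_one {s : Multiset (fiber triangle b)} (hs : EnergyMinimal s)
    {u v : fiber triangle b} (hu : u ∈ s) (hv : v ∈ s) {j : Fin 6} (hj : j = 0 ∨ j = 3 ∨ j = 5) :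
    u.1 j ≤ v.1 j + 1 := by
  by_contra! hlt
  have huv : u ≠ v := by
    rintro rfl
    omega
  obtain ⟨l, hl1, -, hl3⟩ := exists_graver_decomposition (sub_mem_moves_of_mem_fiber v.2 u.2)
  obtain ⟨a, ha, hapos⟩ : ∃ a ∈ l, 0 < graver a j := by
    by_contra! hno
    have := hl1 j
    have hle : (l.map fun a => graver a j).sum ≤ 0 := by
      refine (List.sum_le_card_nsmul _ 0 fun x hx => ?_).trans_eq (nsmul_zero _)
      obtain ⟨a, ha, rfl⟩ := List.mem_map.mp hx
      exact hno a ha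
    omega
  have hone : graver a j = 1 := by
    have hle : ∀ a, graver a 0 ≤ 1 ∧ graver a 3 ≤ 1 ∧ graver a 5 ≤ 1 := by decide
    have := hle a
    rcases hj with rfl | rfl | rfl <;> omega
  have hconf := hl3 a ha
  simp only [Conformal] at hconf
  have h := hs.exchange hu hv huv (neg_mem_moves_triangle (graver_mem_moves a))
    (fun i => by have := hconf i; simp only [Pi.neg_apply]; omega)
    (fun i => by have := hconf i; simp only [Pi.neg_apply]; omega)
  have hneg : ∑ i, (-graver a) i * ((u.1 i : ℤ) - v.1 i + (-graver a) i) < 0 := by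
    refine Finset.sum_neg' (fun i _ => ?_) ⟨j, Finset.mem_univ _, ?_⟩
    · rw [Pi.neg_apply, neg_mul, neg_nonpos]
      rcases hconf i with h | h
      · exact mul_nonneg h.1 (by omega)
      · exact mul_nonneg_of_nonpos_of_nonpos h.2 (by omega)
    · rw [Pi.neg_apply, hone]
      omega
  omega

end Exchange

/-- Two multisets of natural numbers with the same cardinality and the same sum lie in a common
interval of length one, if each of them lies in some interval of length one. -/
theorem exists_common_unit_interval {S T : Multiset ℕ} (hS : ∀ x ∈ S, ∀ y ∈ S, x ≤ y + 1)
    (hT : ∀ x ∈ T, ∀ y ∈ T, x ≤ y + 1) (hcard : S.card = T.card) (hsum : S.sum = T.sum) :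
    ∃ k, (∀ x ∈ S, x = k ∨ x = k + 1) ∧ ∀ x ∈ T, x = k ∨ x = k + 1 := by
  rcases S.empty_or_exists_mem with rfl | ⟨s, hs⟩
  · rw [Multiset.card_zero, eq_comm, Multiset.card_eq_zero] at hcard
    subst hcard
    exact ⟨0, by simp⟩
  have hmin : ∀ {R : Multiset ℕ}, 0 < R.card → ∃ m ∈ R, ∀ x ∈ R, m ≤ x := fun {R} hR => by
    obtain ⟨r, hr⟩ := Multiset.card_pos_iff_exists_mem.mp hR
    obtain ⟨m, hm, h⟩ := R.toFinset.exists_min_image id ⟨r, Multiset.mem_toFinset.mpr hr⟩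
    exact ⟨m, Multiset.mem_toFinset.mp hm, fun x hx => h x (Multiset.mem_toFinset.mpr hx)⟩
  have hpos : 0 < S.card := Multiset.card_pos_iff_exists_mem.mpr ⟨s, hs⟩
  obtain ⟨m, hm, hmS⟩ := hmin hpos
  obtain ⟨n, hn, hnT⟩ := hmin (hcard ▸ hpos)
  have hlt : ∀ {R : Multiset ℕ} {m : ℕ}, m ∈ R → (∀ x ∈ R, x ≤ m + 1) →
      R.sum < R.card * (m + 1) := fun {R m} hm h => by
    obtain ⟨R', rfl⟩ := Multiset.exists_cons_of_mem hm
    have := Multiset.sum_le_card_nsmul R' (m + 1) fun x hx => h x (Multiset.mem_cons_of_mem hx)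
    rw [smul_eq_mul] at this
    rw [Multiset.sum_cons, Multiset.card_cons, add_mul]
    omega
  have h1 := hlt hm fun x hx => hS x hx m hm
  have h2 := hlt hn fun x hx => hT x hx n hn
  have h3 := Multiset.card_nsmul_le_sum hmS
  have h4 := Multiset.card_nsmul_le_sum hnT
  rw [smul_eq_mul] at h3 h4
  rw [hcard, hsum] at *
  have h5 : m < n + 1 := lt_of_mul_lt_mul_left' (h3.trans_lt h2)
  have h6 : n < m + 1 := lt_of_mul_lt_mul_left' (h4.trans_lt h1)
  obtain rfl : m = n := by omega
  refine ⟨m, fun x hx => ?_, fun x hx => ?_⟩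
  · have := hmS x hx
    have := hS x hx m hm
    omega
  · have := hnT x hx
    have := hT x hx m hn
    omega

/-! ### Uniqueness of multisets of minimal energy -/

section Cube

variable {b : Fin 3 → ℤ}

/-- The number of elements of `s` with `α, β, γ` loops at the three vertices. -/
def loopCount (s : Multiset (fiber triangle b)) (α β γ : ℕ) : ℕ :=
  s.countP fun v => v.1 0 = α ∧ v.1 3 = β ∧ v.1 5 = γ

theorem exists_mem_of_loopCount_ne_zero {s : Multiset (fiber triangle b)} {α β γ : ℕ}
    (h : loopCount s α β γ ≠ 0) : ∃ v ∈ s, v.1 0 = α ∧ v.1 3 = β ∧ v.1 5 = γ :=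
  Multiset.countP_pos.mp (Nat.pos_of_ne_zero h)

theorem loopCount_ne_zero_of_mem {s : Multiset (fiber triangle b)} {v : fiber triangle b}
    (h : v ∈ s) : loopCount s (v.1 0) (v.1 3) (v.1 5) ≠ 0 :=
  (Multiset.countP_pos.mpr ⟨v, h, rfl, rfl, rfl⟩).ne'

/-- Cardinality and loop sums of a multiset whose loop numbers lie in a unit cube, in terms of
the multiplicities of the vertices of the cube. -/
theorem loopCount_equations (x y z : ℕ) (s : Multiset (fiber triangle b))
    (h : ∀ v ∈ s, (v.1 0 = x ∨ v.1 0 = x + 1) ∧ (v.1 3 = y ∨ v.1 3 = y + 1) ∧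
      (v.1 5 = z ∨ v.1 5 = z + 1)) :
    (s.card = loopCount s x y z + loopCount s (x + 1) y z + loopCount s x (y + 1) z +
      loopCount s x y (z + 1) + loopCount s (x + 1) (y + 1) z + loopCount s (x + 1) y (z + 1) +
      loopCount s x (y + 1) (z + 1) + loopCount s (x + 1) (y + 1) (z + 1)) ∧
    (vecSum s 0 = s.card * x + loopCount s (x + 1) y z + loopCount s (x + 1) (y + 1) z +
      loopCount s (x + 1) y (z + 1) + loopCount s (x + 1) (y + 1) (z + 1)) ∧
    (vecSum s 3 = s.card * y + loopCount s x (y + 1) z + loopCount s (x + 1) (y + 1) z +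
      loopCount s x (y + 1) (z + 1) + loopCount s (x + 1) (y + 1) (z + 1)) ∧
    (vecSum s 5 = s.card * z + loopCount s x y (z + 1) + loopCount s (x + 1) y (z + 1) +
      loopCount s x (y + 1) (z + 1) + loopCount s (x + 1) (y + 1) (z + 1)) := by
  induction s using Multiset.induction with
  | empty => simp [loopCount, vecSum]
  | cons v s ih =>
    obtain ⟨h1, h2, h3, h4⟩ := ih fun u hu => h u (Multiset.mem_cons_of_mem hu)
    obtain ⟨ha, hb, hc⟩ := h v (Multiset.mem_cons_self v s)
    simp only [vecSum_cons, Pi.add_apply, Multiset.card_cons, add_mul, one_mul]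
    rw [h2, h3, h4]
    simp only [loopCount, Multiset.countP_cons] at *
    generalize s.card * x = X
    generalize s.card * y = Y
    generalize s.card * z = Z
    rcases ha with ha | ha <;> rcases hb with hb | hb <;> rcases hc with hc | hc <;>
      simp [ha, hb, hc] <;> omega

theorem sum_map_apply (s : Multiset (fiber triangle b)) (j : Fin 6) :
    (s.map fun v => v.1 j).sum = vecSum s j := by
  induction s using Multiset.induction with
  | empty => simp [vecSum]
  | cons v s ih => simp [vecSum_cons, ih]

/-- The loop numbers of two multisets of minimal energy with the same cardinality and the same sum
lie in a common unit cube. -/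
theorem exists_common_cube {s t : Multiset (fiber triangle b)} (hs : EnergyMinimal s)
    (ht : EnergyMinimal t) (hcard : s.card = t.card) (hsum : vecSum s = vecSum t) {j : Fin 6}
    (hj : j = 0 ∨ j = 3 ∨ j = 5) :
    ∃ k, (∀ v ∈ s, v.1 j = k ∨ v.1 j = k + 1) ∧ ∀ v ∈ t, v.1 j = k ∨ v.1 j = k + 1 := by
  obtain ⟨k, h1, h2⟩ := exists_common_unit_interval (S := s.map fun v => v.1 j)
    (T := t.map fun v => v.1 j)
    (by
      simp only [Multiset.mem_map]
      rintro _ ⟨u, hu, rfl⟩ _ ⟨v, hv, rfl⟩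
      exact hs.loop_le_add_one hu hv hj)
    (by
      simp only [Multiset.mem_map]
      rintro _ ⟨u, hu, rfl⟩ _ ⟨v, hv, rfl⟩
      exact ht.loop_le_add_one hu hv hj)
    (by simpa using hcard) (by rw [sum_map_apply, sum_map_apply, hsum])
  exact ⟨k, fun v hv => h1 _ (Multiset.mem_map_of_mem _ hv),
    fun v hv => h2 _ (Multiset.mem_map_of_mem _ hv)⟩

/-- An element of the fiber with `x, y, z` loops, if there is one, has `p, q, r` edges `ab, ac, bc`.
These numbers may be negative, in which case there is no such element. -/
def EdgeOffsets (b : Fin 3 → ℤ) (x y z : ℕ) (p q r : ℤ) : Prop :=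
  b 0 = 2 * x + p + q ∧ b 1 = 2 * y + p + r ∧ b 2 = 2 * z + q + r

/-- The numbers of the edges `ab, ac, bc` of an element with `α, β, γ` loops more than `x, y, z` are
`p + γ - α - β`, `q + β - α - γ` and `r + α - β - γ`. -/
theorem EdgeOffsets.edge_eqs {x y z : ℕ} {p q r : ℤ} (h : EdgeOffsets b x y z p q r)
    (v : fiber triangle b) :
    (v.1 1 : ℤ) = p + (v.1 5 - z) - (v.1 0 - x) - (v.1 3 - y) ∧
    (v.1 2 : ℤ) = q + (v.1 3 - y) - (v.1 0 - x) - (v.1 5 - z) ∧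
    (v.1 4 : ℤ) = r + (v.1 0 - x) - (v.1 3 - y) - (v.1 5 - z) := by
  have := fiber_triangle_eqs v
  obtain ⟨h1, h2, h3⟩ := h
  omega

theorem exists_edgeOffsets (v : fiber triangle b) (x y z : ℕ) :
    ∃ p q r, EdgeOffsets b x y z p q r := by
  have := fiber_triangle_eqs v
  refine ⟨v.1 1 - (v.1 5 - z) + (v.1 0 - x) + (v.1 3 - y),
    v.1 2 - (v.1 3 - y) + (v.1 0 - x) + (v.1 5 - z),
    v.1 4 - (v.1 0 - x) + (v.1 3 - y) + (v.1 5 - z), ?_, ?_, ?_⟩ <;> omega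

/-- If a multiset of minimal energy contains `u` and `v`, then no kernel vector that lowers the
energy can be moved from `v` to `u`. -/
theorem EnergyMinimal.not_exchange {s : Multiset (fiber triangle b)} (hs : EnergyMinimal s)
    {u v : fiber triangle b} (hu : u ∈ s) (hv : v ∈ s) (α β γ : ℤ)
    (hu' : ∀ j, 0 ≤ (u.1 j : ℤ) + kerVec α β γ j) (hv' : ∀ j, 0 ≤ (v.1 j : ℤ) - kerVec α β γ j)
    (hlt : ∑ j, kerVec α β γ j * ((u.1 j : ℤ) - v.1 j + kerVec α β γ j) < 0) : False := by
  have huv : u ≠ v := by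
    rintro rfl
    refine absurd hlt (not_lt.mpr (Finset.sum_nonneg fun j _ => ?_))
    rw [sub_self, zero_add]
    exact mul_self_nonneg _
  exact absurd hlt (not_lt.mpr (hs.exchange hu hv huv (kerVec_mem_moves α β γ) hu' hv'))

/-- Two elements of a multiset of minimal energy in a unit cube are comparable, unless their meet or
their join is not in the fiber: the exchange for meet and join would lower the energy. -/
theorem EnergyMinimal.comparable {s : Multiset (fiber triangle b)} (hs : EnergyMinimal s)
    {x y z : ℕ} {p q r : ℤ} (h : EdgeOffsets b x y z p q r) (hp : 1 ≤ p) (hq : 1 ≤ q)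
    (hr : 1 ≤ r) :
    (loopCount s (x + 1) (y + 1) z = 0 ∨ loopCount s (x + 1) y (z + 1) = 0) ∧
    (loopCount s (x + 1) (y + 1) z = 0 ∨ loopCount s x (y + 1) (z + 1) = 0) ∧
    (loopCount s (x + 1) y (z + 1) = 0 ∨ loopCount s x (y + 1) (z + 1) = 0) ∧
    (loopCount s (x + 1) y z = 0 ∨ loopCount s x (y + 1) (z + 1) = 0) ∧
    (loopCount s x (y + 1) z = 0 ∨ loopCount s (x + 1) y (z + 1) = 0) ∧
    (loopCount s x y (z + 1) = 0 ∨ loopCount s (x + 1) (y + 1) z = 0) ∧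
    (2 ≤ p → loopCount s (x + 1) y z = 0 ∨ loopCount s x (y + 1) z = 0) ∧
    (2 ≤ q → loopCount s (x + 1) y z = 0 ∨ loopCount s x y (z + 1) = 0) ∧
    (2 ≤ r → loopCount s x (y + 1) z = 0 ∨ loopCount s x y (z + 1) = 0) := by
  have key : ∀ {α β γ α' β' γ' : ℕ} (A B C : ℤ), (∀ u ∈ s, ∀ v ∈ s,
      u.1 0 = α → u.1 3 = β → u.1 5 = γ → v.1 0 = α' → v.1 3 = β' → v.1 5 = γ' →
      (∀ j, 0 ≤ (u.1 j : ℤ) + kerVec A B C j) ∧ (∀ j, 0 ≤ (v.1 j : ℤ) - kerVec A B C j) ∧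
      ∑ j, kerVec A B C j * ((u.1 j : ℤ) - v.1 j + kerVec A B C j) < 0) →
      loopCount s α β γ = 0 ∨ loopCount s α' β' γ' = 0 := by
    intro α β γ α' β' γ' A B C h
    by_contra! hno
    obtain ⟨u, hu, h1, h2, h3⟩ := exists_mem_of_loopCount_ne_zero hno.1
    obtain ⟨v, hv, h4, h5, h6⟩ := exists_mem_of_loopCount_ne_zero hno.2
    obtain ⟨h7, h8, h9⟩ := h u hu v hv h1 h2 h3 h4 h5 h6
    exact hs.not_exchange hu hv A B C h7 h8 h9
  refine ⟨key 0 (-1) 0 ?_, key (-1) 0 0 ?_, key (-1) 0 0 ?_, key (-1) 0 0 ?_, key 0 (-1) 0 ?_,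
    key 0 0 (-1) ?_, fun hp' => key (-1) 0 0 ?_, fun hq' => key (-1) 0 0 ?_,
    fun hr' => key 0 (-1) 0 ?_⟩ <;>
  · intro u _ v _ h1 h2 h3 h4 h5 h6
    have hu := h.edge_eqs u
    have hv := h.edge_eqs v
    simp [Fin.forall_fin_succ, Fin.sum_univ_succ, kerVec]
    omega

end Cube

section Cube

variable {b : Fin 3 → ℤ}

/-- The place where the fiber of `(2, 2, 2)` is exceptional. In the cube with `p = q = r = 1`, the three
vertices with one additional loop have the same sum as the bottom vertex, taken twice, and the top
vertex. If there is a loop, say `x ≥ 1`, below the cube, then two quadratic exchanges through an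
element with `x - 1` loops lead from the former to the latter, at lower energy. -/
theorem EnergyMinimal.not_three_atoms {s : Multiset (fiber triangle b)} (hs : EnergyMinimal s)
    (hb : b ≠ ![2, 2, 2]) {x y z : ℕ} (h : EdgeOffsets b x y z 1 1 1) :
    loopCount s (x + 1) y z = 0 ∨ loopCount s x (y + 1) z = 0 ∨ loopCount s x y (z + 1) = 0 := by
  by_contra! hno
  obtain ⟨u, hu, hu0, hu3, hu5⟩ := exists_mem_of_loopCount_ne_zero hno.1
  obtain ⟨v, hv, hv0, hv3, hv5⟩ := exists_mem_of_loopCount_ne_zero hno.2.1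
  obtain ⟨w, hw, hw0, hw3, hw5⟩ := exists_mem_of_loopCount_ne_zero hno.2.2
  have eu := h.edge_eqs u
  have ev := h.edge_eqs v
  have ew := h.edge_eqs w
  have huv : u ≠ v := by rintro rfl; omega
  have huw : u ≠ w := by rintro rfl; omega
  have hvw : v ≠ w := by rintro rfl; omega
  have hxyz : 1 ≤ x ∨ 1 ≤ y ∨ 1 ≤ z := by
    by_contra! h0
    obtain ⟨h1, h2, h3⟩ := h
    apply hb
    ext i
    fin_cases i <;> simp <;> omega
  rcases hxyz with h0 | h0 | h0
  · have := hs.exchange_twice hv hw hu hvw huv.symm huw.symm (kerVec_mem_moves (-1) (-1) 0)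
      (kerVec_mem_moves 1 0 0)
      (by simp [Fin.forall_fin_succ, kerVec]; omega) (by simp [Fin.forall_fin_succ, kerVec]; omega)
      (by simp [Fin.forall_fin_succ, kerVec]; omega) (by simp [Fin.forall_fin_succ, kerVec]; omega)
    simp [Fin.sum_univ_succ, kerVec] at this
    omega
  · have := hs.exchange_twice hu hw hv huw huv hvw.symm (kerVec_mem_moves (-1) (-1) 0)
      (kerVec_mem_moves 0 1 0)
      (by simp [Fin.forall_fin_succ, kerVec]; omega) (by simp [Fin.forall_fin_succ, kerVec]; omega)
      (by simp [Fin.forall_fin_succ, kerVec]; omega) (by simp [Fin.forall_fin_succ, kerVec]; omega)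
    simp [Fin.sum_univ_succ, kerVec] at this
    omega
  · have := hs.exchange_twice hu hv hw huv huw hvw (kerVec_mem_moves (-1) 0 (-1))
      (kerVec_mem_moves 0 0 1)
      (by simp [Fin.forall_fin_succ, kerVec]; omega) (by simp [Fin.forall_fin_succ, kerVec]; omega)
      (by simp [Fin.forall_fin_succ, kerVec]; omega) (by simp [Fin.forall_fin_succ, kerVec]; omega)
    simp [Fin.sum_univ_succ, kerVec] at this
    omega

/-- An occupied vertex of the cube belongs to the fiber, so it has non-negative edge numbers. -/
theorem EdgeOffsets.nonneg_of_loopCount_ne_zero {x y z : ℕ} {p q r : ℤ}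
    (h : EdgeOffsets b x y z p q r) (s : Multiset (fiber triangle b)) :
    (loopCount s (x + 1) y z ≠ 0 → 1 ≤ p ∧ 1 ≤ q) ∧
    (loopCount s x (y + 1) z ≠ 0 → 1 ≤ p ∧ 1 ≤ r) ∧
    (loopCount s x y (z + 1) ≠ 0 → 1 ≤ q ∧ 1 ≤ r) ∧
    (loopCount s (x + 1) (y + 1) z ≠ 0 → 2 ≤ p) ∧
    (loopCount s (x + 1) y (z + 1) ≠ 0 → 2 ≤ q) ∧
    (loopCount s x (y + 1) (z + 1) ≠ 0 → 2 ≤ r) ∧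
    (loopCount s (x + 1) (y + 1) (z + 1) ≠ 0 → 1 ≤ p ∧ 1 ≤ q ∧ 1 ≤ r) := by
  refine ⟨?_, ?_, ?_, ?_, ?_, ?_, ?_⟩ <;>
  · intro h0
    obtain ⟨v, -, h1, h2, h3⟩ := exists_mem_of_loopCount_ne_zero h0
    have := h.edge_eqs v
    omega

end Cube

/-- The possible supports of a multiset of minimal energy in a unit cube: either no join of two atoms
occurs and some atom is missing, or exactly one join occurs, with at most one of its atoms and
without the third atom. -/
theorem cube_support_shape {n1 n2 n3 n4 n5 n6 : ℕ} {p q r : ℤ} (n4p : n4 ≠ 0 → 2 ≤ p)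
    (n5q : n5 ≠ 0 → 2 ≤ q) (n6r : n6 ≠ 0 → 2 ≤ r) (a1 : n4 = 0 ∨ n5 = 0) (a2 : n4 = 0 ∨ n6 = 0)
    (a3 : n5 = 0 ∨ n6 = 0) (a4 : n1 = 0 ∨ n6 = 0) (a5 : n2 = 0 ∨ n5 = 0) (a6 : n3 = 0 ∨ n4 = 0)
    (a7 : 2 ≤ p → n1 = 0 ∨ n2 = 0) (a8 : 2 ≤ q → n1 = 0 ∨ n3 = 0) (a9 : 2 ≤ r → n2 = 0 ∨ n3 = 0)
    (hn : p = 1 → q = 1 → r = 1 → n1 = 0 ∨ n2 = 0 ∨ n3 = 0) (hp : 1 ≤ p) (hq : 1 ≤ q)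
    (hr : 1 ≤ r) :
    (n4 = 0 ∧ n5 = 0 ∧ n6 = 0 ∧ (n1 = 0 ∨ n2 = 0 ∨ n3 = 0)) ∨
      (2 ≤ p ∧ n4 ≠ 0 ∧ n5 = 0 ∧ n6 = 0 ∧ n3 = 0 ∧ (n1 = 0 ∨ n2 = 0)) ∨
      (2 ≤ q ∧ n5 ≠ 0 ∧ n4 = 0 ∧ n6 = 0 ∧ n2 = 0 ∧ (n1 = 0 ∨ n3 = 0)) ∨
      (2 ≤ r ∧ n6 ≠ 0 ∧ n4 = 0 ∧ n5 = 0 ∧ n1 = 0 ∧ (n2 = 0 ∨ n3 = 0)) := by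
  by_cases h4 : n4 = 0
  · by_cases h5 : n5 = 0
    · by_cases h6 : n6 = 0
      · refine Or.inl ⟨h4, h5, h6, ?_⟩
        clear n4p n5q n6r a1 a2 a3 a4 a5 a6 h4 h5 h6
        by_cases hp2 : 2 ≤ p
        · have := a7 hp2
          tauto
        by_cases hq2 : 2 ≤ q
        · have := a8 hq2
          tauto
        by_cases hr2 : 2 ≤ r
        · have := a9 hr2
          tauto
        exact hn (by omega) (by omega) (by omega)
      · exact Or.inr (Or.inr (Or.inr ⟨n6r h6, h6, h4, h5, a4.resolve_right h6, a9 (n6r h6)⟩))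
    · exact Or.inr (Or.inr (Or.inl ⟨n5q h5, h5, h4, a3.resolve_left h5, a5.resolve_right h5,
        a8 (n5q h5)⟩))
  · exact Or.inr (Or.inl ⟨n4p h4, h4, a1.resolve_left h4, a2.resolve_left h4, a6.resolve_right h4,
      a7 (n4p h4)⟩)

/-- Uniqueness on the supports of `cube_support_shape`, for `p, q, r ≥ 1`. A join of two atoms can
only occur in both multisets or in none, as it makes two coordinate sums exceed the third one. -/
theorem cube_counts_unique_of_support_shape
    {n0 n1 n2 n3 n4 n5 n6 n7 m0 m1 m2 m3 m4 m5 m6 m7 : ℕ} {p q r : ℤ}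
    (e0 : n0 + n1 + n2 + n3 + n4 + n5 + n6 + n7 = m0 + m1 + m2 + m3 + m4 + m5 + m6 + m7)
    (e1 : n1 + n4 + n5 + n7 = m1 + m4 + m5 + m7) (e2 : n2 + n4 + n6 + n7 = m2 + m4 + m6 + m7)
    (e3 : n3 + n5 + n6 + n7 = m3 + m5 + m6 + m7)
    (a7 : 2 ≤ p → n1 = 0 ∨ n2 = 0) (a8 : 2 ≤ q → n1 = 0 ∨ n3 = 0) (a9 : 2 ≤ r → n2 = 0 ∨ n3 = 0)
    (c7 : 2 ≤ p → m1 = 0 ∨ m2 = 0) (c8 : 2 ≤ q → m1 = 0 ∨ m3 = 0) (c9 : 2 ≤ r → m2 = 0 ∨ m3 = 0)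
    (hn : ((n4 = 0 ∧ n5 = 0 ∧ n6 = 0 ∧ (n1 = 0 ∨ n2 = 0 ∨ n3 = 0)) ∨
      (2 ≤ p ∧ n4 ≠ 0 ∧ n5 = 0 ∧ n6 = 0 ∧ n3 = 0 ∧ (n1 = 0 ∨ n2 = 0)) ∨
      (2 ≤ q ∧ n5 ≠ 0 ∧ n4 = 0 ∧ n6 = 0 ∧ n2 = 0 ∧ (n1 = 0 ∨ n3 = 0)) ∨
      (2 ≤ r ∧ n6 ≠ 0 ∧ n4 = 0 ∧ n5 = 0 ∧ n1 = 0 ∧ (n2 = 0 ∨ n3 = 0))))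
    (hm : ((m4 = 0 ∧ m5 = 0 ∧ m6 = 0 ∧ (m1 = 0 ∨ m2 = 0 ∨ m3 = 0)) ∨
      (2 ≤ p ∧ m4 ≠ 0 ∧ m5 = 0 ∧ m6 = 0 ∧ m3 = 0 ∧ (m1 = 0 ∨ m2 = 0)) ∨
      (2 ≤ q ∧ m5 ≠ 0 ∧ m4 = 0 ∧ m6 = 0 ∧ m2 = 0 ∧ (m1 = 0 ∨ m3 = 0)) ∨
      (2 ≤ r ∧ m6 ≠ 0 ∧ m4 = 0 ∧ m5 = 0 ∧ m1 = 0 ∧ (m2 = 0 ∨ m3 = 0)))) :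
    n0 = m0 ∧ n1 = m1 ∧ n2 = m2 ∧ n3 = m3 ∧ n4 = m4 ∧ n5 = m5 ∧ n6 = m6 ∧ n7 = m7 := by
  rcases hn with ⟨h4, h5, h6, h⟩ | ⟨h2, h4, h5, h6, h3, h⟩ | ⟨h2, h5, h4, h6, h3, h⟩ |
      ⟨h2, h6, h4, h5, h3, h⟩ <;>
    rcases hm with ⟨k4, k5, k6, k⟩ | ⟨k2, k4, k5, k6, k3, k⟩ | ⟨k2, k5, k4, k6, k3, k⟩ |
      ⟨k2, k6, k4, k5, k3, k⟩
  · clear a7 a8 a9 c7 c8 c9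
    omega
  · have := a7 k2
    clear a7 a8 a9 c7 c8 c9
    omega
  · have := a8 k2
    clear a7 a8 a9 c7 c8 c9
    omega
  · have := a9 k2
    clear a7 a8 a9 c7 c8 c9
    omega
  · have := c7 h2
    clear a7 a8 a9 c7 c8 c9
    omega
  · clear a7 a8 a9 c7 c8 c9
    omega
  · clear a7 a8 a9 c7 c8 c9
    omega
  · clear a7 a8 a9 c7 c8 c9
    omega
  · have := c8 h2
    clear a7 a8 a9 c7 c8 c9
    omega
  · clear a7 a8 a9 c7 c8 c9
    omega
  · clear a7 a8 a9 c7 c8 c9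
    omega
  · clear a7 a8 a9 c7 c8 c9
    omega
  · have := c9 h2
    clear a7 a8 a9 c7 c8 c9
    omega
  · clear a7 a8 a9 c7 c8 c9
    omega
  · clear a7 a8 a9 c7 c8 c9
    omega
  · clear a7 a8 a9 c7 c8 c9
    omega

/-- A multiset of vertices of the unit cube with the given cardinality and coordinate sums is unique
if it is supported on a chain or on vertices that are affinely independent for another reason: on a
facet of the fiber (`p ≤ 0` etc.), or bottom and top together with two atoms whose join is not in the
fiber. The vertices are numbered `000, 100, 010, 001, 110, 101, 011, 111`. -/
theorem cube_counts_unique {n0 n1 n2 n3 n4 n5 n6 n7 m0 m1 m2 m3 m4 m5 m6 m7 : ℕ} {p q r : ℤ}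
    (e0 : n0 + n1 + n2 + n3 + n4 + n5 + n6 + n7 = m0 + m1 + m2 + m3 + m4 + m5 + m6 + m7)
    (e1 : n1 + n4 + n5 + n7 = m1 + m4 + m5 + m7) (e2 : n2 + n4 + n6 + n7 = m2 + m4 + m6 + m7)
    (e3 : n3 + n5 + n6 + n7 = m3 + m5 + m6 + m7)
    (hn : (n1 ≠ 0 → 1 ≤ p ∧ 1 ≤ q) ∧ (n2 ≠ 0 → 1 ≤ p ∧ 1 ≤ r) ∧ (n3 ≠ 0 → 1 ≤ q ∧ 1 ≤ r) ∧
      (n4 ≠ 0 → 2 ≤ p) ∧ (n5 ≠ 0 → 2 ≤ q) ∧ (n6 ≠ 0 → 2 ≤ r) ∧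
      (n7 ≠ 0 → 1 ≤ p ∧ 1 ≤ q ∧ 1 ≤ r))
    (hm : (m1 ≠ 0 → 1 ≤ p ∧ 1 ≤ q) ∧ (m2 ≠ 0 → 1 ≤ p ∧ 1 ≤ r) ∧ (m3 ≠ 0 → 1 ≤ q ∧ 1 ≤ r) ∧
      (m4 ≠ 0 → 2 ≤ p) ∧ (m5 ≠ 0 → 2 ≤ q) ∧ (m6 ≠ 0 → 2 ≤ r) ∧
      (m7 ≠ 0 → 1 ≤ p ∧ 1 ≤ q ∧ 1 ≤ r))
    (hn' : 1 ≤ p → 1 ≤ q → 1 ≤ r → (n4 = 0 ∨ n5 = 0) ∧ (n4 = 0 ∨ n6 = 0) ∧ (n5 = 0 ∨ n6 = 0) ∧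
      (n1 = 0 ∨ n6 = 0) ∧ (n2 = 0 ∨ n5 = 0) ∧ (n3 = 0 ∨ n4 = 0) ∧ (2 ≤ p → n1 = 0 ∨ n2 = 0) ∧
      (2 ≤ q → n1 = 0 ∨ n3 = 0) ∧ (2 ≤ r → n2 = 0 ∨ n3 = 0))
    (hm' : 1 ≤ p → 1 ≤ q → 1 ≤ r → (m4 = 0 ∨ m5 = 0) ∧ (m4 = 0 ∨ m6 = 0) ∧ (m5 = 0 ∨ m6 = 0) ∧
      (m1 = 0 ∨ m6 = 0) ∧ (m2 = 0 ∨ m5 = 0) ∧ (m3 = 0 ∨ m4 = 0) ∧ (2 ≤ p → m1 = 0 ∨ m2 = 0) ∧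
      (2 ≤ q → m1 = 0 ∨ m3 = 0) ∧ (2 ≤ r → m2 = 0 ∨ m3 = 0))
    (hn3 : p = 1 → q = 1 → r = 1 → n1 = 0 ∨ n2 = 0 ∨ n3 = 0)
    (hm3 : p = 1 → q = 1 → r = 1 → m1 = 0 ∨ m2 = 0 ∨ m3 = 0) :
    n0 = m0 ∧ n1 = m1 ∧ n2 = m2 ∧ n3 = m3 ∧ n4 = m4 ∧ n5 = m5 ∧ n6 = m6 ∧ n7 = m7 := by
  by_cases hp : p ≤ 0
  · clear hn' hm' hn3 hm3
    have h1 : n1 = 0 ∧ n2 = 0 ∧ n4 = 0 ∧ n7 = 0 := by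
      clear hm
      omega
    have h2 : m1 = 0 ∧ m2 = 0 ∧ m4 = 0 ∧ m7 = 0 := by
      clear hn
      omega
    clear hn hm
    omega
  by_cases hq : q ≤ 0
  · clear hn' hm' hn3 hm3
    have h1 : n1 = 0 ∧ n3 = 0 ∧ n5 = 0 ∧ n7 = 0 := by
      clear hm
      omega
    have h2 : m1 = 0 ∧ m3 = 0 ∧ m5 = 0 ∧ m7 = 0 := by
      clear hn
      omega
    clear hn hm
    omega
  by_cases hr : r ≤ 0
  · clear hn' hm' hn3 hm3
    have h1 : n2 = 0 ∧ n3 = 0 ∧ n6 = 0 ∧ n7 = 0 := by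
      clear hm
      omega
    have h2 : m2 = 0 ∧ m3 = 0 ∧ m6 = 0 ∧ m7 = 0 := by
      clear hn
      omega
    clear hn hm
    omega
  obtain ⟨-, -, -, n4p, n5q, n6r, -⟩ := hn
  obtain ⟨-, -, -, m4p, m5q, m6r, -⟩ := hm
  obtain ⟨a1, a2, a3, a4, a5, a6, a7, a8, a9⟩ := hn' (by omega) (by omega) (by omega)
  obtain ⟨c1, c2, c3, c4, c5, c6, c7, c8, c9⟩ := hm' (by omega) (by omega) (by omega)
  clear hn' hm'
  have shape_n := cube_support_shape n4p n5q n6r a1 a2 a3 a4 a5 a6 a7 a8 a9 hn3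
    (by omega) (by omega) (by omega)
  have shape_m := cube_support_shape m4p m5q m6r c1 c2 c3 c4 c5 c6 c7 c8 c9 hm3
    (by omega) (by omega) (by omega)
  exact cube_counts_unique_of_support_shape e0 e1 e2 e3 a7 a8 a9 c7 c8 c9 shape_n shape_m

section Cube

variable {b : Fin 3 → ℤ}

/-- Non-empty multisets of minimal energy with the same cardinality and the same sum have a common
element; in fact they are equal. -/
theorem EnergyMinimal.exists_common_mem {s t : Multiset (fiber triangle b)} (hs : EnergyMinimal s)
    (ht : EnergyMinimal t) (hb : b ≠ ![2, 2, 2]) (hcard : s.card = t.card)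
    (hsum : vecSum s = vecSum t) (hpos : s ≠ 0) : ∃ v, v ∈ s ∧ v ∈ t := by
  obtain ⟨x, hx, hx'⟩ := exists_common_cube hs ht hcard hsum (j := 0) (by simp)
  obtain ⟨y, hy, hy'⟩ := exists_common_cube hs ht hcard hsum (j := 3) (by simp)
  obtain ⟨z, hz, hz'⟩ := exists_common_cube hs ht hcard hsum (j := 5) (by simp)
  obtain ⟨v, hv⟩ := Multiset.exists_mem_of_ne_zero hpos
  obtain ⟨p, q, r, h⟩ := exists_edgeOffsets v x y z
  obtain ⟨s0, s1, s2, s3⟩ := loopCount_equations x y z s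
    fun v hv => ⟨hx v hv, hy v hv, hz v hv⟩
  obtain ⟨t0, t1, t2, t3⟩ := loopCount_equations x y z t
    fun v hv => ⟨hx' v hv, hy' v hv, hz' v hv⟩
  rw [← hsum, ← hcard] at t1 t2 t3
  rw [← hcard] at t0
  have key := cube_counts_unique (p := p) (q := q) (r := r) (s0.symm.trans t0) (by omega)
    (by omega) (by omega) (h.nonneg_of_loopCount_ne_zero s) (h.nonneg_of_loopCount_ne_zero t)
    (hs.comparable h) (ht.comparable h)
    (by rintro rfl rfl rfl; exact hs.not_three_atoms hb h)
    (by rintro rfl rfl rfl; exact ht.not_three_atoms hb h)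
  obtain ⟨k0, k1, k2, k3, k4, k5, k6, k7⟩ := key
  have hv0 := loopCount_ne_zero_of_mem hv
  have hv1 : loopCount t (v.1 0) (v.1 3) (v.1 5) ≠ 0 := by
    rcases hx v hv with h1 | h1 <;> rcases hy v hv with h2 | h2 <;> rcases hz v hv with h3 | h3 <;>
    · rw [h1, h2, h3] at hv0 ⊢
      omega
  obtain ⟨u, hu, h1, h2, h3⟩ := exists_mem_of_loopCount_ne_zero hv1
  obtain rfl := fiber_triangle_ext h1 h2 h3
  exact ⟨u, hv, hu⟩

/-- For `b ≠ (2, 2, 2)`, multisets of fiber elements with the same cardinality and the same sum are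
connected by quadratic exchanges. -/
theorem quadConn_of_vecSum_eq (hb : b ≠ ![2, 2, 2]) (s t : Multiset (fiber triangle b))
    (hcard : s.card = t.card) (hsum : vecSum s = vecSum t) : QuadConn s t := by
  induction hn : s.card generalizing s t with
  | zero =>
    rw [Multiset.card_eq_zero] at hn
    subst hn
    rw [Multiset.card_zero, eq_comm, Multiset.card_eq_zero] at hcard
    rw [hcard]
  | succ n ih =>
    obtain ⟨s', hs, hs'⟩ := exists_energyMinimal s
    obtain ⟨t', ht, ht'⟩ := exists_energyMinimal t
    have es := hs.card_eq_and_vecSum_eq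
    have et := ht.card_eq_and_vecSum_eq
    have hcard' : s'.card = t'.card := by omega
    have hsum' : vecSum s' = vecSum t' := by rw [← es.2, ← et.2, hsum]
    obtain ⟨v, hv, hv'⟩ := hs'.exists_common_mem ht' hb hcard' hsum' (by
      rintro rfl
      rw [Multiset.card_zero] at es
      omega)
    obtain ⟨s'', rfl⟩ := Multiset.exists_cons_of_mem hv
    obtain ⟨t'', rfl⟩ := Multiset.exists_cons_of_mem hv'
    rw [Multiset.card_cons, Multiset.card_cons] at *
    rw [vecSum_cons, vecSum_cons] at hsum'
    exact hs.trans (((ih s'' t'' (by omega) (add_left_cancel hsum') (by omega)).cons v).trans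
      ht.symm)

end Cube

/-! ### From exchanges of multisets to Markov degrees -/

section MarkovDegree

variable {b : Fin 3 → ℤ}

/-- At most `m` elements of the multiset `s` are replaced by at most `m` elements with the same
sum. -/
def ExchangeStep (m : ℕ) (s t : Multiset (fiber triangle b)) : Prop :=
  ∃ p q w, s = p + w ∧ t = q + w ∧ vecSum p = vecSum q ∧ p.card ≤ m ∧ q.card ≤ m

theorem vecSum_add (s t : Multiset (fiber triangle b)) : vecSum (s + t) = vecSum s + vecSum t := by
  simp [vecSum]

theorem ExchangeStep.symm {m : ℕ} {s t : Multiset (fiber triangle b)} (h : ExchangeStep m s t) :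
    ExchangeStep m t s := by
  obtain ⟨p, q, w, h1, h2, h3, h4, h5⟩ := h
  exact ⟨q, p, w, h2, h1, h3.symm, h5, h4⟩

theorem QuadStep.exchangeStep {s t : Multiset (fiber triangle b)} (h : QuadStep s t) :
    ExchangeStep 2 s t := by
  obtain ⟨u, v, u', v', w, rfl, rfl, h⟩ := h
  exact ⟨{u, v}, {u', v'}, w, by simp [Multiset.singleton_add],
    by simp [Multiset.singleton_add], by simpa [vecSum] using h, by simp, by simp⟩

theorem exists_count_eq (x : fiber triangle b → ℕ) :
    ∃ s : Multiset (fiber triangle b), (fun v => s.count v) = x :=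
  ⟨Finsupp.toMultiset (Finsupp.equivFunOnFinite.symm x),
    funext fun v => by rw [Finsupp.count_toMultiset]; rfl⟩

theorem fiberMatrix_mulVec_count (s : Multiset (fiber triangle b)) :
    (fiberMatrix triangle b *ᵥ fun v => (s.count v : ℤ)) = fun j => (vecSum s j : ℤ) := by
  ext j
  rw [← sum_map_apply, Finset.sum_multiset_map_count]
  simp only [Matrix.mulVec, dotProduct, fiberMatrix, Matrix.of_apply, smul_eq_mul]
  push_cast
  rw [Finset.sum_subset (Finset.subset_univ s.toFinset) fun v _ hv => by
    rw [Multiset.mem_toFinset] at hv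
    rw [Multiset.count_eq_zero_of_notMem hv]
    simp]
  exact Finset.sum_congr rfl fun v _ => mul_comm _ _

theorem count_mem_fiber_iff (s : Multiset (fiber triangle b)) (c : Fin 6 → ℤ) :
    (fun v => s.count v) ∈ fiber (fiberMatrix triangle b) c ↔ (fun j => (vecSum s j : ℤ)) = c := by
  rw [← fiberMatrix_mulVec_count]
  rfl

theorem sum_count_univ (s : Multiset (fiber triangle b)) : ∑ v, s.count v = s.card :=
  Multiset.sum_count_eq_card fun v _ => Finset.mem_univ v

theorem degree_count_sub_count_le {m : ℕ} {p q w : Multiset (fiber triangle b)} (hp : p.card ≤ m)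
    (hq : q.card ≤ m) :
    degree (fun v => ((q + w).count v : ℤ) - ((p + w).count v : ℤ)) ≤ m := by
  refine max_le (le_trans ?_ hq) (le_trans ?_ hp)
  · rw [← sum_count_univ]
    refine Finset.sum_le_sum fun v _ => ?_
    simp only [Multiset.count_add]
    omega
  · rw [← sum_count_univ]
    refine Finset.sum_le_sum fun v _ => ?_
    simp only [Multiset.count_add]
    omega

/-- Connectedness of multisets with the same sum by exchanges of at most `m` elements bounds the
Markov degree. -/
theorem isMarkovBasis_of_exchange {m : ℕ}
    (h : ∀ s t : Multiset (fiber triangle b), vecSum s = vecSum t →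
      Relation.ReflTransGen (ExchangeStep m) s t) :
    IsMarkovBasis (fiberMatrix triangle b)
      {z | z ∈ moves (fiberMatrix triangle b) ∧ degree z ≤ m} := by
  refine ⟨fun z hz => hz.1, fun c x hx y hy => ?_⟩
  obtain ⟨s, rfl⟩ := exists_count_eq x
  obtain ⟨t, rfl⟩ := exists_count_eq y
  have hs := (count_mem_fiber_iff s c).mp hx
  have ht := (count_mem_fiber_iff t c).mp hy
  have hst : vecSum s = vecSum t := funext fun j => by
    have h1 := congrFun hs j
    have h2 := congrFun ht j
    omega
  have key := h s t hst
  clear hy ht hst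
  induction key with
  | refl => exact .refl
  | @tail u t' hsu hstep ih =>
    obtain ⟨p, q, w, rfl, rfl, hpq, hp, hq⟩ := hstep
    have hmid := ih
    have hfib : (fun v => (p + w).count v) ∈ fiber (fiberMatrix triangle b) c := by
      rcases Relation.ReflTransGen.cases_tail hmid with h | ⟨_, _, h⟩
      · rw [h]
        exact hx
      · exact h.2.1
    have hfib' : (fun v => (q + w).count v) ∈ fiber (fiberMatrix triangle b) c := by
      rw [count_mem_fiber_iff] at hfib ⊢
      rw [vecSum_add, ← hpq, ← vecSum_add, hfib]
    exact hmid.tail ⟨hfib, hfib', Or.inl ⟨sub_mem_moves_of_mem_fiber hfib hfib',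
      degree_count_sub_count_le hp hq⟩⟩

theorem markovDegree_le_of_exchange {m : ℕ}
    (h : ∀ s t : Multiset (fiber triangle b), vecSum s = vecSum t →
      Relation.ReflTransGen (ExchangeStep m) s t) :
    markovDegree (fiberMatrix triangle b) ≤ m :=
  iInf₂_le m (isMarkovBasis_of_exchange h)

/-- For `b ≠ 0` the sum of a multiset of fiber elements determines its cardinality, since all
elements have the same vertex degrees. -/
theorem card_eq_of_vecSum_eq (hb : b ≠ 0) {s t : Multiset (fiber triangle b)}
    (h : vecSum s = vecSum t) : s.card = t.card := by
  have key : ∀ s : Multiset (fiber triangle b),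
      (s.card : ℤ) * b 0 = 2 * vecSum s 0 + vecSum s 1 + vecSum s 2 ∧
      (s.card : ℤ) * b 1 = vecSum s 1 + 2 * vecSum s 3 + vecSum s 4 ∧
      (s.card : ℤ) * b 2 = vecSum s 2 + vecSum s 4 + 2 * vecSum s 5 := by
    intro s
    induction s using Multiset.induction with
    | empty => simp [vecSum]
    | cons v s ih =>
      have := fiber_triangle_eqs v
      simp only [Multiset.card_cons, vecSum_cons, Pi.add_apply]
      push_cast
      simp only [add_mul, one_mul]
      omega
  obtain ⟨i, hi⟩ := Function.ne_iff.mp hb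
  have hs := key s
  have ht := key t
  rw [h] at hs
  have hmul : (s.card : ℤ) * b i = t.card * b i := by
    fin_cases i
    · exact hs.1.trans ht.1.symm
    · exact hs.2.1.trans ht.2.1.symm
    · exact hs.2.2.trans ht.2.2.symm
  exact_mod_cast mul_right_cancel₀ hi hmul

/-- If `b = 0`, the only element of the fiber is zero, so elements can be removed one by one. -/
theorem exchange_zero (hb : b = 0) (s : Multiset (fiber triangle b)) :
    Relation.ReflTransGen (ExchangeStep 2) 0 s := by
  induction s using Multiset.induction with
  | empty => exact .refl
  | cons v s ih =>
    refine ih.tail ⟨0, {v}, s, by simp, rfl, ?_, by simp, by simp⟩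
    have := fiber_triangle_eqs v
    subst hb
    simp only [Pi.zero_apply] at this
    ext j
    fin_cases j <;> simp [vecSum] <;> omega

theorem markovDegree_fiberMatrix_le_two (hb : b ≠ ![2, 2, 2]) :
    markovDegree (fiberMatrix triangle b) ≤ 2 := by
  refine markovDegree_le_of_exchange fun s t hst => ?_
  by_cases h0 : b = 0
  · have : Std.Symm (ExchangeStep (b := b) 2) := ⟨fun _ _ => ExchangeStep.symm⟩
    exact (Std.Symm.symm _ _ (exchange_zero h0 s)).trans (exchange_zero h0 t)
  · exact Relation.ReflTransGen.mono (fun _ _ => QuadStep.exchangeStep) _ _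
      (quadConn_of_vecSum_eq hb s t (card_eq_of_vecSum_eq h0 hst) hst)

/-- If `M` is a Markov basis and the multiset `s` has the same sum as a different multiset, then some
step of `M` in the fiber leads from `s` to a multiset different from `s`. -/
theorem exists_move_of_isMarkovBasis {M : Set (fiber triangle b → ℤ)}
    (hM : IsMarkovBasis (fiberMatrix triangle b) M) {s t : Multiset (fiber triangle b)}
    (hst : vecSum s = vecSum t) (hne : s ≠ t) :
    ∃ u : Multiset (fiber triangle b), u ≠ s ∧ vecSum u = vecSum s ∧
      ((fun v => (u.count v : ℤ) - s.count v) ∈ M ∨ (fun v => (s.count v : ℤ) - u.count v) ∈ M) := by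
  by_contra! hno
  have hstay : ∀ y, Relation.ReflTransGen (Step (fiberMatrix triangle b) M
      fun j => (vecSum s j : ℤ)) (fun v => s.count v) y → y = fun v => s.count v := by
    intro y hy
    induction hy with
    | refl => rfl
    | @tail y z _ hstep ih =>
      subst ih
      obtain ⟨u, rfl⟩ := exists_count_eq z
      by_contra h
      have hu := (count_mem_fiber_iff u _).mp hstep.2.1
      obtain ⟨h1, h2⟩ := hno u (by rintro rfl; exact h rfl) (funext fun j => by
        have := congrFun hu j
        omega)
      exact hstep.2.2.elim h1 h2
  have heq := hstay _ (hM.2 _ (fun v => s.count v) ((count_mem_fiber_iff s _).mpr rfl)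
    (fun v => t.count v) ((count_mem_fiber_iff t _).mpr (by rw [hst])))
  exact hne (Multiset.ext.mpr fun v => (congrFun heq v).symm)

end MarkovDegree

section LowerBounds

variable {b : Fin 3 → ℤ}

theorem card_sub_le_of_degree_le {m : ℕ} {s t : Multiset (fiber triangle b)}
    (h : degree (fun v => (t.count v : ℤ) - (s.count v : ℤ)) ≤ m) :
    (t - s).card ≤ m ∧ (s - t).card ≤ m := by
  obtain ⟨h1, h2⟩ := max_le_iff.mp h
  refine ⟨(le_of_eq ?_).trans h1, (le_of_eq ?_).trans h2⟩
  · rw [← sum_count_univ]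
    refine Finset.sum_congr rfl fun v _ => ?_
    simp only [Multiset.count_sub]
    omega
  · rw [← sum_count_univ]
    refine Finset.sum_congr rfl fun v _ => ?_
    simp only [Multiset.count_sub]
    omega

/-- If the Markov degree is at most `m`, a multiset `s` that shares its sum with another one differs
by at most `m` elements from some multiset `u ≠ s` with the same sum. -/
theorem exists_close_of_isMarkovBasis {m : ℕ}
    (hM : IsMarkovBasis (fiberMatrix triangle b)
      {z | z ∈ moves (fiberMatrix triangle b) ∧ degree z ≤ m})
    {s t : Multiset (fiber triangle b)} (hst : vecSum s = vecSum t) (hne : s ≠ t) :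
    ∃ u : Multiset (fiber triangle b), u ≠ s ∧ vecSum u = vecSum s ∧ (u - s).card ≤ m ∧
      (s - u).card ≤ m := by
  obtain ⟨u, h1, h2, h3 | h3⟩ := exists_move_of_isMarkovBasis hM hst hne
  · exact ⟨u, h1, h2, card_sub_le_of_degree_le h3.2⟩
  · exact ⟨u, h1, h2, (card_sub_le_of_degree_le h3.2).symm⟩

/-- For `b ≠ 0`, different multisets with the same sum differ by at least two elements. -/
theorem two_le_card_sub (hb : b ≠ 0) {s u : Multiset (fiber triangle b)} (hne : u ≠ s)
    (hsum : vecSum u = vecSum s) : 2 ≤ (u - s).card := by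
  have hu : (u - s) + (u ∩ s) = u := Multiset.sub_add_inter u s
  have hs : (s - u) + (u ∩ s) = s := by rw [Multiset.inter_comm, Multiset.sub_add_inter]
  have hv : vecSum ((u - s) + (u ∩ s)) = vecSum ((s - u) + (u ∩ s)) := by rw [hu, hs, hsum]
  rw [vecSum_add, vecSum_add] at hv
  replace hv := add_right_cancel hv
  have hc := card_eq_of_vecSum_eq hb hv
  by_contra! hlt
  suffices h : u - s = s - u from hne (hu.symm.trans ((congrArg (· + u ∩ s) h).trans hs))
  have hcases : (u - s).card = 0 ∨ (u - s).card = 1 := by omega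
  rcases hcases with h0 | h1
  · rw [Multiset.card_eq_zero.mp h0, Multiset.card_eq_zero.mp (hc.symm.trans h0)]
  · obtain ⟨x, hx⟩ := Multiset.card_eq_one.mp h1
    obtain ⟨y, hy⟩ := Multiset.card_eq_one.mp (hc.symm.trans h1)
    rw [hx, hy] at hv ⊢
    simp only [vecSum, Multiset.map_singleton, Multiset.sum_singleton] at hv
    rw [Subtype.ext hv]

/-- The fiber of `(4, 4, 0)` has an arithmetic progression of length three. -/
theorem two_le_markovDegree_fiber_four_four_zero :
    2 ≤ markovDegree (fiberMatrix triangle ![4, 4, 0]) := by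
  refine le_iInf₂ fun m hm => ?_
  let u : fiber triangle ![4, 4, 0] := ⟨![2, 0, 0, 2, 0, 0], by unfold fiber triangle; decide⟩
  let v : fiber triangle ![4, 4, 0] := ⟨![1, 2, 0, 1, 0, 0], by unfold fiber triangle; decide⟩
  let w : fiber triangle ![4, 4, 0] := ⟨![0, 4, 0, 0, 0, 0], by unfold fiber triangle; decide⟩
  have hsum : vecSum {v, v} = vecSum {u, w} := by
    simp only [vecSum, Multiset.insert_eq_cons, Multiset.map_cons, Multiset.map_singleton,
      Multiset.sum_cons, Multiset.sum_singleton, u, v, w]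
    decide
  have hne : ({v, v} : Multiset _) ≠ {u, w} := by
    intro h
    have hu : u ∈ ({v, v} : Multiset _) := by rw [h]; simp
    simp [u, v] at hu
  obtain ⟨s, h1, h2, h3, -⟩ := exists_close_of_isMarkovBasis hm hsum hne
  have := two_le_card_sub (fun h => by have := congrFun h 0; simp at this) h1 h2
  exact_mod_cast this.trans h3

end LowerBounds

/-! ### The fiber of `(2, 2, 2)` -/

section TwoTwoTwo

theorem eq_col (v : fiber triangle ![2, 2, 2]) :
    v = col1 ∨ v = col2 ∨ v = col3 ∨ v = col4 ∨ v = col5 := by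
  have h := fiber_triangle_eqs v
  simp at h
  have hc : (v.1 0 = 1 ∧ v.1 3 = 1 ∧ v.1 5 = 1) ∨ (v.1 0 = 1 ∧ v.1 3 = 0 ∧ v.1 5 = 0) ∨
      (v.1 0 = 0 ∧ v.1 3 = 0 ∧ v.1 5 = 1) ∨ (v.1 0 = 0 ∧ v.1 3 = 0 ∧ v.1 5 = 0) ∨
      (v.1 0 = 0 ∧ v.1 3 = 1 ∧ v.1 5 = 0) := by omega
  rcases hc with ⟨h0, h3, h5⟩ | ⟨h0, h3, h5⟩ | ⟨h0, h3, h5⟩ | ⟨h0, h3, h5⟩ | ⟨h0, h3, h5⟩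
  · exact Or.inl (fiber_triangle_ext h0 h3 h5)
  · exact Or.inr (Or.inl (fiber_triangle_ext h0 h3 h5))
  · exact Or.inr (Or.inr (Or.inl (fiber_triangle_ext h0 h3 h5)))
  · exact Or.inr (Or.inr (Or.inr (Or.inl (fiber_triangle_ext h0 h3 h5))))
  · exact Or.inr (Or.inr (Or.inr (Or.inr (fiber_triangle_ext h0 h3 h5))))

/-- The multiset `a₁ + 2 a₄` of the cubic relation. -/
def cubicLeft : Multiset (fiber triangle ![2, 2, 2]) := {col1, col4, col4}

/-- The multiset `a₂ + a₃ + a₅` of the cubic relation. -/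
def cubicRight : Multiset (fiber triangle ![2, 2, 2]) := {col2, col3, col5}

theorem vecSum_cubic : vecSum cubicLeft = vecSum cubicRight := by
  decide

theorem vecSum_two_two_two (s : Multiset (fiber triangle ![2, 2, 2])) :
    vecSum s 0 = s.count col1 + s.count col2 ∧ vecSum s 1 = 2 * s.count col3 + s.count col4 ∧
    vecSum s 2 = s.count col4 + 2 * s.count col5 ∧ vecSum s 3 = s.count col1 + s.count col5 ∧
    vecSum s 4 = 2 * s.count col2 + s.count col4 ∧ vecSum s 5 = s.count col1 + s.count col3 := by
  induction s using Multiset.induction with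
  | empty => simp [vecSum]
  | cons v s ih =>
    obtain ⟨i0, i1, i2, i3, i4, i5⟩ := ih
    simp only [vecSum_cons, Pi.add_apply, Multiset.count_cons, i0, i1, i2, i3, i4, i5]
    rcases eq_col v with rfl | rfl | rfl | rfl | rfl
    · simp +decide only [↓reduceIte, add_zero]
      simp [col1]
      omega
    · simp +decide only [↓reduceIte, add_zero]
      simp [col2]
      omega
    · simp +decide only [↓reduceIte, add_zero]
      simp [col3]
      omega
    · simp +decide only [↓reduceIte, add_zero]
      simp [col4]
      omega
    · simp +decide only [↓reduceIte, add_zero]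
      simp [col5]
      omega

theorem count_cubic :
    (cubicLeft.count col1 = 1 ∧ cubicLeft.count col2 = 0 ∧ cubicLeft.count col3 = 0 ∧
      cubicLeft.count col4 = 2 ∧ cubicLeft.count col5 = 0) ∧
    (cubicRight.count col1 = 0 ∧ cubicRight.count col2 = 1 ∧ cubicRight.count col3 = 1 ∧
      cubicRight.count col4 = 0 ∧ cubicRight.count col5 = 1) := by
  decide

theorem multiset_ext_col {s t : Multiset (fiber triangle ![2, 2, 2])}
    (h1 : s.count col1 = t.count col1) (h2 : s.count col2 = t.count col2)
    (h3 : s.count col3 = t.count col3) (h4 : s.count col4 = t.count col4)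
    (h5 : s.count col5 = t.count col5) : s = t := by
  ext v
  rcases eq_col v with rfl | rfl | rfl | rfl | rfl <;> assumption

/-- The kernel of `A_(2,2,2)` has rank one: multisets with the same sum differ by a multiple of
the cubic relation. -/
theorem exists_nsmul_cubic {s t : Multiset (fiber triangle ![2, 2, 2])} (h : vecSum s = vecSum t) :
    ∃ (k : ℕ) (w : _), (s = k • cubicLeft + w ∧ t = k • cubicRight + w) ∨
      (s = k • cubicRight + w ∧ t = k • cubicLeft + w) := by
  wlog hle : t.count col1 ≤ s.count col1 generalizing s t
  · obtain ⟨k, w, h'⟩ := this h.symm (le_of_not_ge hle)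
    exact ⟨k, w, h'.symm.imp And.symm And.symm⟩
  obtain ⟨s0, s1, s2, s3, s4, s5⟩ := vecSum_two_two_two s
  obtain ⟨t0, t1, t2, t3, t4, t5⟩ := vecSum_two_two_two t
  obtain ⟨⟨l1, l2, l3, l4, l5⟩, r1, r2, r3, r4, r5⟩ := count_cubic
  rw [h] at s0 s1 s2 s3 s4 s5
  set k := s.count col1 - t.count col1 with hk
  have hs : s = k • cubicLeft + (s - k • cubicLeft) := by
    apply multiset_ext_col <;>
      simp only [Multiset.count_add, Multiset.count_sub, Multiset.count_nsmul, l1, l2, l3, l4, l5] <;>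
      omega
  refine ⟨k, s - k • cubicLeft, Or.inl ⟨hs, ?_⟩⟩
  apply multiset_ext_col <;>
    simp only [Multiset.count_add, Multiset.count_sub, Multiset.count_nsmul, l1, l2, l3, l4, l5,
      r1, r2, r3, r4, r5] <;>
    omega

theorem exchange_nsmul_cubic (k : ℕ) (w : Multiset (fiber triangle ![2, 2, 2])) :
    Relation.ReflTransGen (ExchangeStep 3) (k • cubicLeft + w) (k • cubicRight + w) := by
  induction k generalizing w with
  | zero => simp only [zero_smul]; exact .refl
  | succ k ih =>
    refine .head ⟨cubicLeft, cubicRight, k • cubicLeft + w, ?_, rfl, vecSum_cubic, le_rfl, le_rfl⟩ ?_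
    · rw [succ_nsmul', add_assoc]
    · rw [add_left_comm, succ_nsmul, add_assoc]
      exact ih _

theorem markovDegree_two_two_two : markovDegree (fiberMatrix triangle ![2, 2, 2]) = 3 := by
  refine le_antisymm (markovDegree_le_of_exchange (m := 3) fun s t h => ?_)
    (le_iInf₂ fun m hm => ?_)
  · have : Std.Symm (ExchangeStep (b := ![2, 2, 2]) 3) := ⟨fun _ _ => ExchangeStep.symm⟩
    obtain ⟨k, w, ⟨rfl, rfl⟩ | ⟨rfl, rfl⟩⟩ := exists_nsmul_cubic h
    · exact exchange_nsmul_cubic k w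
    · exact Std.Symm.symm _ _ (exchange_nsmul_cubic k w)
  · -- the two sides of the cubic relation are alone in their fiber
    obtain ⟨u, hne, hsum, h3, -⟩ := exists_close_of_isMarkovBasis hm vecSum_cubic (by decide)
    have hu : u = cubicRight := by
      obtain ⟨s0, s1, s2, s3, s4, s5⟩ := vecSum_two_two_two u
      obtain ⟨t0, t1, t2, t3, t4, t5⟩ := vecSum_two_two_two cubicLeft
      obtain ⟨⟨l1, l2, l3, l4, l5⟩, r1, r2, r3, r4, r5⟩ := count_cubic
      rw [hsum] at s0 s1 s2 s3 s4 s5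
      have h0 : u.count col1 ≠ 1 := fun h1 => hne (multiset_ext_col (by omega) (by omega)
        (by omega) (by omega) (by omega))
      exact multiset_ext_col (by omega) (by omega) (by omega) (by omega) (by omega)
    subst hu
    have hcard : (cubicRight - cubicLeft).card = 3 := by decide
    rw [hcard] at h3
    exact_mod_cast h3

/-! ### The toric ideal -/

variable (K : Type*) [Field K]

/-- The monomial with the given multiset of variables. -/
noncomputable def multisetMonomial {σ : Type*} (s : Multiset σ) : MvPolynomial σ K :=
  (s.map MvPolynomial.X).prod

theorem multisetMonomial_add {σ : Type*} (s t : Multiset σ) :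
    multisetMonomial K (s + t) = multisetMonomial K s * multisetMonomial K t := by
  simp [multisetMonomial]

theorem multisetMonomial_nsmul {σ : Type*} (k : ℕ) (s : Multiset σ) :
    multisetMonomial K (k • s) = multisetMonomial K s ^ k := by
  simp [multisetMonomial, Multiset.map_nsmul, Multiset.prod_nsmul]

theorem monomial_eq_smul_multisetMonomial {σ : Type*} (m : σ →₀ ℕ) (c : K) :
    MvPolynomial.monomial m c = c • multisetMonomial K (Finsupp.toMultiset m) := by
  rw [MvPolynomial.monomial_eq, MvPolynomial.smul_eq_C_mul, multisetMonomial, Finsupp.toMultiset_map,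
    Finsupp.prod_toMultiset, Finsupp.prod_mapDomain_index (by simp) (by intros; rw [pow_add])]

theorem aeval_multisetMonomial {b : Fin 3 → ℤ} (s : Multiset (fiber triangle b)) :
    MvPolynomial.aeval (R := K) (fun v => (AddMonoidAlgebra.single
      (fun i => fiberMatrix triangle b i v) 1 : AddMonoidAlgebra K (Fin 6 → ℤ)))
      (multisetMonomial K s) = AddMonoidAlgebra.single (fun j => (vecSum s j : ℤ)) 1 := by
  induction s using Multiset.induction with
  | empty => simp [multisetMonomial, vecSum]; rfl
  | cons v s ih =>
    rw [← Multiset.singleton_add, multisetMonomial_add, map_mul, ih, Multiset.singleton_add,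
      vecSum_cons]
    simp only [multisetMonomial, Multiset.map_singleton, Multiset.prod_singleton,
      MvPolynomial.aeval_X, AddMonoidAlgebra.single_mul_single, mul_one]
    congr 1

/-- A toric ideal is contained in every ideal that contains the differences of monomials with the
same image: modulo such an ideal, a polynomial can be reconstructed from its image. -/
theorem toricIdeal_le {b : Fin 3 → ℤ} (I : Ideal (MvPolynomial (fiber triangle b) K))
    (h : ∀ s t : Multiset (fiber triangle b), vecSum s = vecSum t →
      multisetMonomial K s - multisetMonomial K t ∈ I) :
    toricIdeal K (fiberMatrix triangle b) ≤ I := by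
  classical
  let φ := MvPolynomial.aeval (R := K) (fun v : fiber triangle b => (AddMonoidAlgebra.single
    (fun i => fiberMatrix triangle b i v) 1 : AddMonoidAlgebra K (Fin 6 → ℤ)))
  let mon : (Fin 6 → ℤ) → MvPolynomial (fiber triangle b) K ⧸ I := fun d =>
    if hd : ∃ s : Multiset (fiber triangle b), (fun j => (vecSum s j : ℤ)) = d then
      Ideal.Quotient.mk I (multisetMonomial K hd.choose) else 0
  let ψ : AddMonoidAlgebra K (Fin 6 → ℤ) →ₗ[K] MvPolynomial (fiber triangle b) K ⧸ I :=
    Finsupp.linearCombination K mon ∘ₗ (AddMonoidAlgebra.coeffLinearEquiv K).toLinearMap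
  have hmon : ∀ s : Multiset (fiber triangle b), mon (fun j => (vecSum s j : ℤ)) =
      Ideal.Quotient.mk I (multisetMonomial K s) := fun s => by
    have hd : ∃ t : Multiset (fiber triangle b),
        (fun j => (vecSum t j : ℤ)) = fun j => (vecSum s j : ℤ) := ⟨s, rfl⟩
    simp only [mon, dif_pos hd]
    rw [Ideal.Quotient.eq]
    refine h _ _ (funext fun j => ?_)
    exact_mod_cast congrFun hd.choose_spec j
  have hψ : ∀ f, ψ (φ f) = Ideal.Quotient.mk I f := by
    intro f
    induction f using MvPolynomial.induction_on' with
    | monomial m c =>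
      rw [monomial_eq_smul_multisetMonomial, map_smul, map_smul, aeval_multisetMonomial]
      change c • Finsupp.linearCombination K mon (Finsupp.single _ 1) = _
      rw [Finsupp.linearCombination_single, one_smul, hmon]
      rfl
    | add p q hp hq => rw [map_add, map_add, map_add, hp, hq]
  intro f hf
  rw [← Ideal.Quotient.eq_zero_iff_mem, ← hψ f, show φ f = 0 from hf, map_zero]

theorem cubic_eq : (MvPolynomial.X col1 * MvPolynomial.X col4 ^ 2 -
    MvPolynomial.X col2 * MvPolynomial.X col3 * MvPolynomial.X col5 :
      MvPolynomial (fiber triangle ![2, 2, 2]) K) =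
    multisetMonomial K cubicLeft - multisetMonomial K cubicRight := by
  simp [multisetMonomial, cubicLeft, cubicRight, pow_two, mul_assoc]

theorem toricIdeal_two_two_two : toricIdeal K (fiberMatrix triangle ![2, 2, 2]) =
    Ideal.span {MvPolynomial.X col1 * MvPolynomial.X col4 ^ 2 -
      MvPolynomial.X col2 * MvPolynomial.X col3 * MvPolynomial.X col5} := by
  rw [cubic_eq]
  refine le_antisymm (toricIdeal_le K _ fun s t h => ?_) ?_
  · have hmk : ∀ (k : ℕ) (w : _), multisetMonomial K (k • cubicLeft + w) -
        multisetMonomial K (k • cubicRight + w) ∈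
        Ideal.span {multisetMonomial K cubicLeft - multisetMonomial K cubicRight} := by
      intro k w
      simp only [multisetMonomial_add, multisetMonomial_nsmul, ← sub_mul]
      exact Ideal.mul_mem_right _ _ (Ideal.mem_span_singleton.mpr (sub_dvd_pow_sub_pow _ _ k))
    obtain ⟨k, w, ⟨rfl, rfl⟩ | ⟨rfl, rfl⟩⟩ := exists_nsmul_cubic h
    · exact hmk k w
    · rw [← neg_mem_iff, neg_sub]
      exact hmk k w
  · rw [Ideal.span_singleton_le_iff_mem, toricIdeal, RingHom.mem_ker]
    change MvPolynomial.aeval _ _ = _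
    rw [map_sub, aeval_multisetMonomial, aeval_multisetMonomial, vecSum_cubic, sub_self]

end TwoTwoTwo

end MarkovConfig

theorem theorem3 (K : Type*) [Field K] :
    -- the maximal Markov degree over all fibers is 3
    IsGreatest {m : ℕ∞ | ∃ b ∈ natSpan triangle, m = markovDegree (fiberMatrix triangle b)} 3 ∧
    -- the Markov complexity is 5
    markovComplexity triangle = 5 ∧
    -- an explicit indispensable move of type 5
    (IsIndispensable (lawrence triangle 5) fiveLayers ∧ moveType fiveLayers = 5) ∧
    -- the maximal Markov degree over all fibers other than that of (2,2,2) is 2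
    IsGreatest {m : ℕ∞ | ∃ b ∈ natSpan triangle \ {![2, 2, 2]},
      m = markovDegree (fiberMatrix triangle b)} 2 ∧
    -- the fiber of (2,2,2): Markov degree 3, and a principal toric ideal with a cubic generator
    markovDegree (fiberMatrix triangle ![2, 2, 2]) = 3 ∧
    toricIdeal K (fiberMatrix triangle ![2, 2, 2]) =
      Ideal.span {MvPolynomial.X col1 * MvPolynomial.X col4 ^ 2 -
        MvPolynomial.X col2 * MvPolynomial.X col3 * MvPolynomial.X col5} := by
  refine ⟨⟨⟨_, ⟨_, col1.2⟩, markovDegree_two_two_two.symm⟩, ?_⟩, markovComplexity_triangle,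
    ⟨fiveLayers_isIndispensable, moveType_fiveLayers⟩, ⟨⟨![4, 4, 0], ⟨?_, ?_⟩, ?_⟩, ?_⟩,
    markovDegree_two_two_two, toricIdeal_two_two_two K⟩
  · rintro _ ⟨b, -, rfl⟩
    by_cases hb : b = ![2, 2, 2]
    · rw [hb, markovDegree_two_two_two]
    · exact (markovDegree_fiberMatrix_le_two hb).trans (by norm_num)
  · exact ⟨![2, 0, 0, 2, 0, 0], by unfold triangle; decide⟩
  · decide
  · exact le_antisymm two_le_markovDegree_fiber_four_four_zero
      (markovDegree_fiberMatrix_le_two (by decide))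
  · rintro _ ⟨b, ⟨-, hb⟩, rfl⟩
    exact markovDegree_fiberMatrix_le_two hb
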